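/- **Setting.** Let $M$ be a Riemannian spin manifold of even dimension $2n\ge 4$ with metric $g$ and Levi-Civita connection $\nabla$. Let $S$ be its complex spinor bundle (rank $2^n$), with Clifford multiplication $\gamma(X)\phi=X\phi$, $XY+YX=-2g(X,Y)$, with a charge conjugation $C$ (a smooth nondegenerate complex bilinear form with $C(\phi,\psi)=\Delta_0C(\psi,\phi)$ and $C(\phi,X\psi)=\Delta_1C(\psi,X\phi)$, $\Delta_0,\Delta_1\in\{\pm1\}$), and with the Levi-Civita connection, also written $\nabla$, for which $\gamma$ and $C$ are parallel. Write $\gamma_{A_1\ldots A_k}=\gamma_{[A_1}\cdots\gamma_{A_k]}$ for antisymmetrised products (with factor $\frac1{k!}$). For $\Phi\in\mathrm{End}(S)$ let $\Phi^C$ be given by $C(\Phi^C\eta,\xi)=C(\eta,\Phi\xi)$. To a connection $D=\nabla+\mathcal A$ on $S$, $\mathcal A\in\Omega^1(M)\otimes\Gamma\,\mathrm{End}(S)$, one associates $D^C=\nabla-\mathcal A^C$, the expression $(\hat D_X\gamma)(Y)\xi=D_X(Y\xi)-(\nabla_XY)\xi-Y D^C_X\xi$, the torsion $\mathcal T(X,Y)=(\hat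 D_X\gamma)(Y)-(\hat D_Y\gamma)(X)\in\mathrm{End}(S)$, and, in a local orthonormal frame $(e_\mu)$ of $TM$ with $\gamma^\mu=\gamma(e_\mu)$ and $\mathcal T_{\mu\nu}=\mathcal T(e_\mu,e_\nu)$, $$\mathfrak D(\mathcal T;\varphi,\psi)=\sum_{\mu,\nu}\big(\gamma^\mu\varphi\wedge\mathcal T_{\mu\nu}\psi+\gamma^\mu\psi\wedge\mathcal T_{\mu\nu}\varphi\big)\otimes e_\nu\ \in\ \Lambda^2S\otimes TM .$$ Let $\eta$ be a pure spinor field: at every $x\in M$ the null space $N_x=\{X\in T_xM\otimes\mathbb C\mid X\eta=0\}$ has complex dimension $n$. At $x$ choose an orthonormal frame $e_1,\ldots,e_{2n}$ adapted to the complex structure given by $\eta$, i.e. such that the vectors $E_{\bar a}=e_a-i\,e_{a+n}$, $a=1,\ldots,n$, span $N_x$; put $E_a=e_a+i\,e_{a+n}$ and $\gamma^a=\gamma(E_a)$, so that $\gamma^{\bar a}\eta=\gamma(E_{\bar a})\eta=0$. For any orthonormal frame $f_1,\ldots,f_{2n}$ of $T_xM$ put $\gamma^*=\gamma(f_1)\cdots\gamma(f_{2n})$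 if $n$ is even and $\gamma^*=i\,\gamma(f_1)\cdots\gamma(f_{2n})$ if $n$ is odd, and define $w_\eta$ by $\gamma^*\eta=w_\eta\eta$ (the product $w_\eta\gamma^*$ does not depend on the orientation of $f$). **Proposition.** Let $F$ be a (possibly complex valued) 3-form on $M$ and let $D=\nabla+\mathcal A$ be the connection on $S$ given by $\mathcal A_\mu=F_{\mu\nu\kappa}\gamma^{\nu\kappa}$. Let $F^{ijk}$ be the components of $F$, regarded as a 3-vector by means of $g$, in the complex frame $(E_a,E_{\bar a})$, i.e. $F=\sum F^{ijk}E_i\otimes E_j\otimes E_k$. If at the point $x$ $$\sum_{i}\ \sum_{a_1,\ldots,a_n} F^{i\,a_{n-1}a_n}\,\varepsilon_{a_1\ldots a_n}\,\gamma^{a_1\ldots a_{n-2}}\big(\mathbb 1-(-1)^n w_\eta\gamma^*\big)\otimes E_i=0\quad\text{in }\mathrm{End}(S_x)\otimes(T_xM\otimes\mathbb C),$$ where the $a_1,\ldots,a_n$ run over the unbarred indices $1,\ldots,n$, $\varepsilon$ is the totally skew-symmetric symbol, and $i$ runs over all $2n$ barred and unbarred indices, then $\mathfrak D(\mathcal T;\eta,\eta)=0$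 at $x$. In particular, if the condition holds at every point, then $\mathfrak D(\mathcal T;\eta,\eta)=0$. -/

import Mathlib

open Bundle
open scoped Manifold ContDiff TensorProduct

noncomputable section

namespace SpinorTorsion

/-! ### Spinor bundles with charge conjugation

`M` is a smooth Riemannian manifold of dimension `2 * n` modelled on the vector space `E`, and `S`
is a smooth complex vector bundle over `M` with model fibre `F`. -/

/-- A spinor bundle over the Riemannian manifold `M` of dimension `2 * n`: the smooth complex vector
bundle `S` of rank `2 ^ n` with a smooth Clifford multiplication `γ`, `XY + YX = -2 g(X, Y)`
(so that every fibre is the irreducible complex Clifford module), together with a charge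
conjugation: a smooth nondegenerate complex bilinear form `C` for which
`C(φ, ψ) = Δ₀ C(ψ, φ)` and `C(φ, X ψ) = Δ₁ C(ψ, X φ)` with signs `Δ₀`, `Δ₁`;
in particular, `C` is invariant under the spin group. -/
structure SpinorBundle (n : ℕ) (E : Type*) [NormedAddCommGroup E] [NormedSpace ℝ E]
    (M : Type*) [TopologicalSpace M] [ChartedSpace E M] [IsManifold 𝓘(ℝ, E) ∞ M]
    [RiemannianBundle (fun x : M ↦ TangentSpace 𝓘(ℝ, E) x)]
    (F : Type*) [NormedAddCommGroup F] [NormedSpace ℂ F]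
    (S : M → Type*) [TopologicalSpace (TotalSpace F S)]
    [∀ x, AddCommGroup (S x)] [∀ x, Module ℂ (S x)] [∀ x, TopologicalSpace (S x)]
    [FiberBundle F S] where
  finrank_model : Module.finrank ℝ E = 2 * n
  finrank_fiber : ∀ x, Module.finrank ℂ (S x) = 2 ^ n
  /-- Clifford multiplication -/
  γ : ∀ x : M, TangentSpace 𝓘(ℝ, E) x →ₗ[ℝ] Module.End ℂ (S x)
  clifford : ∀ (x : M) (X Y : TangentSpace 𝓘(ℝ, E) x),
    γ x X * γ x Y + γ x Y * γ x X = (-2 * inner ℝ X Y : ℝ) • (1 : Module.End ℂ (S x))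
  smooth_γ : ∀ (X : ∀ x : M, TangentSpace 𝓘(ℝ, E) x) (σ : ∀ x, S x) (x : M),
    ContMDiffAt 𝓘(ℝ, E) (𝓘(ℝ, E).prod 𝓘(ℝ, E)) ∞ (fun y ↦ TotalSpace.mk' E y (X y)) x →
    ContMDiffAt 𝓘(ℝ, E) (𝓘(ℝ, E).prod 𝓘(ℝ, F)) ∞ (fun y ↦ TotalSpace.mk' F y (σ y)) x →
    ContMDiffAt 𝓘(ℝ, E) (𝓘(ℝ, E).prod 𝓘(ℝ, F)) ∞
      (fun y ↦ TotalSpace.mk' F y (γ y (X y) (σ y))) x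
  /-- charge conjugation -/
  C : ∀ x : M, LinearMap.BilinForm ℂ (S x)
  nondegenerate : ∀ x, (C x).Nondegenerate
  smooth_C : ∀ (φ ψ : ∀ x, S x) (x : M),
    ContMDiffAt 𝓘(ℝ, E) (𝓘(ℝ, E).prod 𝓘(ℝ, F)) ∞ (fun y ↦ TotalSpace.mk' F y (φ y)) x →
    ContMDiffAt 𝓘(ℝ, E) (𝓘(ℝ, E).prod 𝓘(ℝ, F)) ∞ (fun y ↦ TotalSpace.mk' F y (ψ y)) x →
    ContMDiffAt 𝓘(ℝ, E) 𝓘(ℝ, ℂ) ∞ (fun y ↦ C y (φ y) (ψ y)) x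
  /-- the sign `Δ₀` -/
  Δ₀ : ℤˣ
  /-- the sign `Δ₁` -/
  Δ₁ : ℤˣ
  symm_C : ∀ (x : M) (φ ψ : S x), C x φ ψ = ((Δ₀ : ℤ) : ℂ) * C x ψ φ
  symm_C_γ : ∀ (x : M) (X : TangentSpace 𝓘(ℝ, E) x) (φ ψ : S x),
    C x φ (γ x X ψ) = ((Δ₁ : ℤ) : ℂ) * C x ψ (γ x X φ)

/-- The antisymmetrised product `A_{[1} ⋯ A_{k]} = (1 / k!) ∑_σ sign(σ) A_{σ 1} ⋯ A_{σ k}`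
of endomorphisms. -/
def antisymmProd {V : Type*} [AddCommGroup V] [Module ℂ V] {k : ℕ}
    (A : Fin k → Module.End ℂ V) : Module.End ℂ V :=
  ((k.factorial : ℂ)⁻¹) • ∑ σ : Equiv.Perm (Fin k),
    ((Equiv.Perm.sign σ : ℤ) : ℂ) • (List.ofFn fun j ↦ A (σ j)).prod

variable {n : ℕ} {E : Type*} [NormedAddCommGroup E] [NormedSpace ℝ E] [FiniteDimensional ℝ E]
  {M : Type*} [TopologicalSpace M] [ChartedSpace E M] [IsManifold 𝓘(ℝ, E) ∞ M]
  [RiemannianBundle (fun x : M ↦ TangentSpace 𝓘(ℝ, E) x)]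
  {F : Type*} [NormedAddCommGroup F] [NormedSpace ℂ F]
  {S : M → Type*} [TopologicalSpace (TotalSpace F S)]
  [∀ x, AddCommGroup (S x)] [∀ x, Module ℂ (S x)] [∀ x, TopologicalSpace (S x)]
  [FiberBundle F S]

namespace SpinorBundle

theorem finiteDimensional (B : SpinorBundle n E M F S) (x : M) : FiniteDimensional ℂ (S x) :=
  FiniteDimensional.of_finrank_pos (by rw [B.finrank_fiber]; positivity)

variable (B : SpinorBundle n E M F S)

/-! ### Charge adjoint -/

/-- The charge adjoint `Φ^C` of an endomorphism: `C(Φ^C η, ξ) = C(η, Φ ξ)`. -/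
def chargeAdj (x : M) (Φ : Module.End ℂ (S x)) : Module.End ℂ (S x) :=
  haveI := B.finiteDimensional x
  (B.C x).leftAdjointOfNondegenerate (B.nondegenerate x) Φ

theorem C_chargeAdj (x : M) (Φ : Module.End ℂ (S x)) (φ ψ : S x) :
    B.C x (B.chargeAdj x Φ φ) ψ = B.C x φ (Φ ψ) :=
  haveI := B.finiteDimensional x
  LinearMap.BilinForm.isAdjointPairLeftAdjointOfNondegenerate (B.C x) (B.nondegenerate x) Φ φ ψ

theorem chargeAdj_eq {x : M} {Φ Ψ : Module.End ℂ (S x)}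
    (h : ∀ φ ψ, B.C x (Ψ φ) ψ = B.C x φ (Φ ψ)) : B.chargeAdj x Φ = Ψ := by
  have := B.finiteDimensional x
  exact ((LinearMap.BilinForm.isAdjointPair_iff_eq_of_nondegenerate (B.C x)
    (B.nondegenerate x) Ψ Φ).1 h).symm

/-- The charge adjoint `𝒜^C` of an endomorphism valued one-form `𝒜`. -/
def chargeAdjForm (A : ∀ x : M, TangentSpace 𝓘(ℝ, E) x →ₗ[ℝ] Module.End ℂ (S x)) (x : M) :
    TangentSpace 𝓘(ℝ, E) x →ₗ[ℝ] Module.End ℂ (S x) where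
  toFun v := B.chargeAdj x (A x v)
  map_add' v w := B.chargeAdj_eq fun φ ψ ↦ by simp [C_chargeAdj]
  map_smul' c v := B.chargeAdj_eq fun φ ψ ↦ by
    simp [← Complex.coe_smul, C_chargeAdj]

end SpinorBundle

/-! ### Connections -/

/-- The Levi-Civita connection on `M`: metric and without torsion. -/
structure IsLeviCivita
    (nablaM : CovariantDerivative 𝓘(ℝ, E) E (fun x : M ↦ TangentSpace 𝓘(ℝ, E) x)) : Prop where
  metric : ∀ (X Y : ∀ x : M, TangentSpace 𝓘(ℝ, E) x) (x : M) (v : TangentSpace 𝓘(ℝ, E) x),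
    MDifferentiableAt 𝓘(ℝ, E) (𝓘(ℝ, E).prod 𝓘(ℝ, E)) (fun y ↦ TotalSpace.mk' E y (X y)) x →
    MDifferentiableAt 𝓘(ℝ, E) (𝓘(ℝ, E).prod 𝓘(ℝ, E)) (fun y ↦ TotalSpace.mk' E y (Y y)) x →
    mfderiv 𝓘(ℝ, E) 𝓘(ℝ, ℝ) (fun y ↦ inner ℝ (X y) (Y y)) x v =
      inner ℝ (nablaM X x v) (Y x) + inner ℝ (X x) (nablaM Y x v)
  torsion_eq_zero : nablaM.torsion = 0

/-- Tangent spaces are finite dimensional (for the module structure of the tangent bundle). -/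
theorem finiteDimensional_tangentSpace (x : M) :
    FiniteDimensional ℝ (TangentSpace 𝓘(ℝ, E) x) :=
  inferInstanceAs (FiniteDimensional ℝ E)

/-- An orthonormal basis `e_1, …, e_{2 n}` of the tangent space at `x`. -/
def frame (x : M) : OrthonormalBasis (Fin (Module.finrank ℝ (TangentSpace 𝓘(ℝ, E) x))) ℝ
    (TangentSpace 𝓘(ℝ, E) x) :=
  haveI := finiteDimensional_tangentSpace (E := E) x
  stdOrthonormalBasis ℝ (TangentSpace 𝓘(ℝ, E) x)

variable [∀ x, IsTopologicalAddGroup (S x)] [∀ x, ContinuousSMul ℝ (S x)]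

/-- The connection `∇ + 𝒜` on `S` which differs from `∇` by the endomorphism valued one-form
`𝒜`. -/
def addForm (nablaS : CovariantDerivative 𝓘(ℝ, E) F S)
    (A : ∀ x : M, TangentSpace 𝓘(ℝ, E) x →ₗ[ℝ] Module.End ℂ (S x)) :
    CovariantDerivative 𝓘(ℝ, E) F S where
  toFun σ x :=
    haveI := finiteDimensional_tangentSpace (E := E) x
    nablaS σ x + LinearMap.toContinuousLinearMap
    ({ toFun := fun v ↦ A x v (σ x)
       map_add' := by simp
       map_smul' := by simp } : TangentSpace 𝓘(ℝ, E) x →ₗ[ℝ] S x)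
  isCovariantDerivativeOnUniv :=
    { add := fun hσ hσ' _ ↦ by
        ext v
        simp [nablaS.isCovariantDerivativeOnUniv.add hσ hσ']
        abel
      leibniz := fun hσ hg _ ↦ by
        ext v
        simp [nablaS.isCovariantDerivativeOnUniv.leibniz hσ hg]
        module }

theorem addForm_apply (nablaS : CovariantDerivative 𝓘(ℝ, E) F S)
    (A : ∀ x : M, TangentSpace 𝓘(ℝ, E) x →ₗ[ℝ] Module.End ℂ (S x))
    (σ : ∀ x, S x) (x : M) (v : TangentSpace 𝓘(ℝ, E) x) :
    addForm nablaS A σ x v = nablaS σ x v + A x v (σ x) := by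
  simp [addForm]

/-- The value `(D̂_v γ)(X) ξ ∈ S_x` for `v, X ∈ T_x M` and `ξ ∈ S_x`, where `D` is a connection on `S`
and `DC` its charge conjugate: `(D̂_v γ)(X) ξ = D_v (X ξ) - (∇_v X) ξ - X DC_v ξ`. The right hand side
is evaluated on a vector field and a section which extend `X` and `ξ`; see
`hatD_γ_apply` for the independence of the extensions. -/
def hatD_γ (B : SpinorBundle n E M F S)
    (nablaM : CovariantDerivative 𝓘(ℝ, E) E (fun x : M ↦ TangentSpace 𝓘(ℝ, E) x))
    (D DC : CovariantDerivative 𝓘(ℝ, E) F S) {x : M} (v X : TangentSpace 𝓘(ℝ, E) x) (ξ : S x) :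
    S x :=
  let X' : ∀ y : M, TangentSpace 𝓘(ℝ, E) y := FiberBundle.extend E X
  let ξ' : ∀ y : M, S y := FiberBundle.extend F ξ
  D (fun y ↦ B.γ y (X' y) (ξ' y)) x v - B.γ x (nablaM X' x v) ξ - B.γ x X (DC ξ' x v)

namespace SpinorBundle

variable (B : SpinorBundle n E M F S)

/-- The Levi-Civita connection on the spinor bundle: the (unique) complex linear connection for
which Clifford multiplication (with the Levi-Civita connection `nablaM` on `M`) and charge
conjugation are parallel. -/
structure IsSpinLeviCivita
    (nablaM : CovariantDerivative 𝓘(ℝ, E) E (fun x : M ↦ TangentSpace 𝓘(ℝ, E) x))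
    (nablaS : CovariantDerivative 𝓘(ℝ, E) F S) : Prop where
  map_smul : ∀ (c : ℂ) (σ : ∀ x, S x) (x : M) (v : TangentSpace 𝓘(ℝ, E) x),
    MDifferentiableAt 𝓘(ℝ, E) (𝓘(ℝ, E).prod 𝓘(ℝ, F)) (fun y ↦ TotalSpace.mk' F y (σ y)) x →
    nablaS (fun y ↦ c • σ y) x v = c • nablaS σ x v
  parallel_γ : ∀ (X : ∀ x : M, TangentSpace 𝓘(ℝ, E) x) (σ : ∀ x, S x) (x : M)
    (v : TangentSpace 𝓘(ℝ, E) x),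
    MDifferentiableAt 𝓘(ℝ, E) (𝓘(ℝ, E).prod 𝓘(ℝ, E)) (fun y ↦ TotalSpace.mk' E y (X y)) x →
    MDifferentiableAt 𝓘(ℝ, E) (𝓘(ℝ, E).prod 𝓘(ℝ, F)) (fun y ↦ TotalSpace.mk' F y (σ y)) x →
    nablaS (fun y ↦ B.γ y (X y) (σ y)) x v =
      B.γ x (nablaM X x v) (σ x) + B.γ x (X x) (nablaS σ x v)
  parallel_C : ∀ (φ ψ : ∀ x, S x) (x : M) (v : TangentSpace 𝓘(ℝ, E) x),
    MDifferentiableAt 𝓘(ℝ, E) (𝓘(ℝ, E).prod 𝓘(ℝ, F)) (fun y ↦ TotalSpace.mk' F y (φ y)) x →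
    MDifferentiableAt 𝓘(ℝ, E) (𝓘(ℝ, E).prod 𝓘(ℝ, F)) (fun y ↦ TotalSpace.mk' F y (ψ y)) x →
    mfderiv 𝓘(ℝ, E) 𝓘(ℝ, ℂ) (fun y ↦ B.C y (φ y) (ψ y)) x v =
      B.C x (nablaS φ x v) (ψ x) + B.C x (φ x) (nablaS ψ x v)

/-- The connection `D^C = ∇ - 𝒜^C` associated to `D = ∇ + 𝒜`. -/
def connC (nablaS : CovariantDerivative 𝓘(ℝ, E) F S)
    (A : ∀ x : M, TangentSpace 𝓘(ℝ, E) x →ₗ[ℝ] Module.End ℂ (S x)) :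
    CovariantDerivative 𝓘(ℝ, E) F S :=
  addForm nablaS (fun x ↦ -B.chargeAdjForm A x)

/-- `D ⊗ 1 + 1 ⊗ D^C` makes the charge conjugation parallel. -/
theorem connC_dual
    {nablaM : CovariantDerivative 𝓘(ℝ, E) E (fun x : M ↦ TangentSpace 𝓘(ℝ, E) x)}
    {nablaS : CovariantDerivative 𝓘(ℝ, E) F S} (hS : B.IsSpinLeviCivita nablaM nablaS)
    (A : ∀ x : M, TangentSpace 𝓘(ℝ, E) x →ₗ[ℝ] Module.End ℂ (S x))
    (φ ψ : ∀ x, S x) (x : M) (v : TangentSpace 𝓘(ℝ, E) x)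
    (hφ : MDifferentiableAt 𝓘(ℝ, E) (𝓘(ℝ, E).prod 𝓘(ℝ, F)) (fun y ↦ TotalSpace.mk' F y (φ y)) x)
    (hψ : MDifferentiableAt 𝓘(ℝ, E) (𝓘(ℝ, E).prod 𝓘(ℝ, F)) (fun y ↦ TotalSpace.mk' F y (ψ y)) x) :
    mfderiv 𝓘(ℝ, E) 𝓘(ℝ, ℂ) (fun y ↦ B.C y (φ y) (ψ y)) x v =
      B.C x (addForm nablaS A φ x v) (ψ x) + B.C x (φ x) (B.connC nablaS A ψ x v) := by
  have h : B.C x (A x v (φ x)) (ψ x) = B.C x (φ x) (B.chargeAdj x (A x v) (ψ x)) := by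
    have hΔ : ((B.Δ₀ : ℤ) : ℂ) * ((B.Δ₀ : ℤ) : ℂ) = 1 := by
      rcases Int.units_eq_one_or B.Δ₀ with h | h <;> simp [h]
    rw [B.symm_C x (φ x), C_chargeAdj, B.symm_C x (ψ x), ← mul_assoc, hΔ, one_mul]
  refine (hS.parallel_C φ ψ x v hφ hψ).trans ?_
  rw [connC, addForm_apply, addForm_apply]
  change B.C x (nablaS φ x v) (ψ x) + B.C x (φ x) (nablaS ψ x v) = _
  simp [chargeAdjForm, h]
  ring

/-- The value of `hatD_γ` does not depend on the extensions. -/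
theorem hatD_γ_apply [VectorBundle ℝ F S] [ContMDiffVectorBundle ∞ F S 𝓘(ℝ, E)]
    {nablaM : CovariantDerivative 𝓘(ℝ, E) E (fun x : M ↦ TangentSpace 𝓘(ℝ, E) x)}
    {nablaS : CovariantDerivative 𝓘(ℝ, E) F S} (hS : B.IsSpinLeviCivita nablaM nablaS)
    (A : ∀ x : M, TangentSpace 𝓘(ℝ, E) x →ₗ[ℝ] Module.End ℂ (S x))
    (X : ∀ x : M, TangentSpace 𝓘(ℝ, E) x) (ξ : ∀ x, S x) (x : M) (v : TangentSpace 𝓘(ℝ, E) x)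
    (hX : MDifferentiableAt 𝓘(ℝ, E) (𝓘(ℝ, E).prod 𝓘(ℝ, E)) (fun y ↦ TotalSpace.mk' E y (X y)) x)
    (hξ : MDifferentiableAt 𝓘(ℝ, E) (𝓘(ℝ, E).prod 𝓘(ℝ, F)) (fun y ↦ TotalSpace.mk' F y (ξ y)) x) :
    hatD_γ B nablaM (addForm nablaS A) (B.connC nablaS A) v (X x) (ξ x) =
      addForm nablaS A (fun y ↦ B.γ y (X y) (ξ y)) x v - B.γ x (nablaM X x v) (ξ x) -
        B.γ x (X x) (B.connC nablaS A ξ x v) := by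
  have key : ∀ (X : ∀ x : M, TangentSpace 𝓘(ℝ, E) x) (ξ : ∀ x, S x),
      MDifferentiableAt 𝓘(ℝ, E) (𝓘(ℝ, E).prod 𝓘(ℝ, E)) (fun y ↦ TotalSpace.mk' E y (X y)) x →
      MDifferentiableAt 𝓘(ℝ, E) (𝓘(ℝ, E).prod 𝓘(ℝ, F)) (fun y ↦ TotalSpace.mk' F y (ξ y)) x →
      addForm nablaS A (fun y ↦ B.γ y (X y) (ξ y)) x v - B.γ x (nablaM X x v) (ξ x) -
        B.γ x (X x) (B.connC nablaS A ξ x v) =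
      A x v (B.γ x (X x) (ξ x)) + B.γ x (X x) (B.chargeAdj x (A x v) (ξ x)) := by
    intro X ξ hX hξ
    rw [connC, addForm_apply, addForm_apply, hS.parallel_γ X ξ x v hX hξ]
    simp [chargeAdjForm]
    abel
  have hX' := key (FiberBundle.extend E (X x)) (FiberBundle.extend F (ξ x))
    (FiberBundle.mdifferentiableAt_extend 𝓘(ℝ, E) E (X x))
    (FiberBundle.mdifferentiableAt_extend 𝓘(ℝ, E) F (ξ x))
  rw [key X ξ hX hξ]
  simp only [FiberBundle.extend_apply_self] at hX'
  exact hX'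

/-- The torsion `𝒯` of the connection `D = ∇ + 𝒜` on `S`, twice the skew symmetrisation of `D̂ γ`:
the value `𝒯(X, Y) ξ = (D̂_X γ)(Y) ξ - (D̂_Y γ)(X) ξ`. -/
def torsion (nablaM : CovariantDerivative 𝓘(ℝ, E) E (fun x : M ↦ TangentSpace 𝓘(ℝ, E) x))
    (nablaS : CovariantDerivative 𝓘(ℝ, E) F S)
    (A : ∀ x : M, TangentSpace 𝓘(ℝ, E) x →ₗ[ℝ] Module.End ℂ (S x)) {x : M}
    (X Y : TangentSpace 𝓘(ℝ, E) x) (ξ : S x) : S x :=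
  hatD_γ B nablaM (addForm nablaS A) (B.connC nablaS A) X Y ξ -
    hatD_γ B nablaM (addForm nablaS A) (B.connC nablaS A) Y X ξ

/-- The value at `x` of
`𝔇(𝒯; φ, ψ) = (γ^μ φ ∧ 𝒯_{μν} ψ + γ^μ ψ ∧ 𝒯_{μν} φ) ⊗ e^ν ∈ Λ² S ⊗ TM`. -/
def frakD (T : ∀ x : M, TangentSpace 𝓘(ℝ, E) x → TangentSpace 𝓘(ℝ, E) x → S x → S x)
    (φ ψ : ∀ x, S x) (x : M) : (⋀[ℂ]^2 (S x)) ⊗[ℝ] TangentSpace 𝓘(ℝ, E) x :=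
  ∑ μ, ∑ ν,
    (exteriorPower.ιMulti ℂ 2
        ![B.γ x (frame x μ) (φ x), T x (frame x μ) (frame x ν) (ψ x)] +
      exteriorPower.ιMulti ℂ 2
        ![B.γ x (frame x μ) (ψ x), T x (frame x μ) (frame x ν) (φ x)]) ⊗ₜ[ℝ] frame x ν

/-- The potential `𝒜_μ = H_{μνκ} γ^{νκ}` of a (complex valued) three-form `H`. -/
def threeFormPotential (H : ∀ x : M, TangentSpace 𝓘(ℝ, E) x [⋀^Fin 3]→ₗ[ℝ] ℂ) (x : M) :
    TangentSpace 𝓘(ℝ, E) x →ₗ[ℝ] Module.End ℂ (S x) where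
  toFun v := ∑ ν, ∑ κ, H x ![v, frame x ν, frame x κ] •
    antisymmProd ![B.γ x (frame x ν), B.γ x (frame x κ)]
  map_add' v w := by
    simp only [← Finset.sum_add_distrib, ← add_smul]
    refine Finset.sum_congr rfl fun ν _ ↦ Finset.sum_congr rfl fun κ _ ↦ ?_
    congr 1
    simpa using (H x).map_vecCons_add ![frame x ν, frame x κ] v w
  map_smul' c v := by
    simp only [Finset.smul_sum, ← smul_assoc, RingHom.id_apply]
    refine Finset.sum_congr rfl fun ν _ ↦ Finset.sum_congr rfl fun κ _ ↦ ?_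
    congr 1
    simpa using (H x).map_vecCons_smul ![frame x ν, frame x κ] c v

/-! ### Pure spinors and the associated complex frames -/

/-- Clifford multiplication by complexified tangent vectors. -/
def γC (x : M) : (ℂ ⊗[ℝ] TangentSpace 𝓘(ℝ, E) x) →ₗ[ℂ] Module.End ℂ (S x) :=
  LinearMap.liftBaseChange ℂ (B.γ x)

/-- A spinor field is pure if at every point its null space `{X ∈ T_x M ⊗ ℂ | X η = 0}` has the
maximal dimension, namely `n`. -/
def IsPure (η : ∀ x, S x) : Prop :=
  ∀ x, Module.finrank ℂ (LinearMap.ker ((LinearMap.applyₗ (R := ℂ) (η x)).comp (B.γC x))) = n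

/-- The chirality operator `γ^*` with respect to the orthonormal frame `f_1, …, f_{2 n}`:
it is `γ^1 ⋯ γ^{2 n}` if `2 n ≡ 0 mod 4` and `i γ^1 ⋯ γ^{2 n}` if `2 n ≡ 2 mod 4`. -/
def gammaStar {x : M} (f : OrthonormalBasis (Fin (2 * n)) ℝ (TangentSpace 𝓘(ℝ, E) x)) :
    Module.End ℂ (S x) :=
  (if Even n then (1 : ℂ) else Complex.I) • (List.ofFn fun μ ↦ B.γ x (f μ)).prod

/-- An orthonormal frame `e_1, …, e_n, e_{n + 1}, …, e_{2 n}` (indexed by `Fin n ⊕ Fin n`) is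
adapted to the complex structure given by the pure spinor `η` if the vectors
`e_a - i e_{a + n}` lie in the null space of `η`. -/
def IsAdapted {x : M} (e : OrthonormalBasis (Fin n ⊕ Fin n) ℝ (TangentSpace 𝓘(ℝ, E) x))
    (η : S x) : Prop :=
  ∀ a : Fin n, B.γ x (e (Sum.inl a)) η - Complex.I • B.γ x (e (Sum.inr a)) η = 0

end SpinorBundle

/-- The complex frame of `T_x M ⊗ ℂ` associated to `e`: the unbarred vectors
`E_a = e_a + i e_{a + n}` (index `Sum.inl a`) and the barred ones `E_ā = e_a - i e_{a + n}`
(index `Sum.inr a`). -/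
def complexFrame {x : M} (e : Fin n ⊕ Fin n → TangentSpace 𝓘(ℝ, E) x) :
    Fin n ⊕ Fin n → ℂ ⊗[ℝ] TangentSpace 𝓘(ℝ, E) x
  | Sum.inl a => (1 : ℂ) ⊗ₜ[ℝ] e (Sum.inl a) + Complex.I ⊗ₜ[ℝ] e (Sum.inr a)
  | Sum.inr a => (1 : ℂ) ⊗ₜ[ℝ] e (Sum.inl a) - Complex.I ⊗ₜ[ℝ] e (Sum.inr a)

/-- The coefficients of the real frame in the complex one, `e_μ = ∑_i P_μ^i E_i`. -/
def frameCoeff (μ i : Fin n ⊕ Fin n) : ℂ :=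
  match μ, i with
  | Sum.inl b, Sum.inl a => if a = b then 1 / 2 else 0
  | Sum.inl b, Sum.inr a => if a = b then 1 / 2 else 0
  | Sum.inr b, Sum.inl a => if a = b then -Complex.I / 2 else 0
  | Sum.inr b, Sum.inr a => if a = b then Complex.I / 2 else 0

theorem sum_frameCoeff {x : M} (e : Fin n ⊕ Fin n → TangentSpace 𝓘(ℝ, E) x)
    (μ : Fin n ⊕ Fin n) :
    ∑ i, frameCoeff μ i • complexFrame e i = (1 : ℂ) ⊗ₜ[ℝ] e μ := by
  rcases μ with b | b
  · simp only [Fintype.sum_sum_type, frameCoeff, complexFrame, ite_smul, zero_smul,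
      Finset.sum_ite_eq', Finset.mem_univ, if_true]
    module
  · simp only [Fintype.sum_sum_type, frameCoeff, complexFrame, ite_smul, zero_smul,
      Finset.sum_ite_eq', Finset.mem_univ, if_true]
    have h : (1 : ℂ) ⊗ₜ[ℝ] e (Sum.inr b) =
        (-Complex.I) • ((Complex.I : ℂ) ⊗ₜ[ℝ] e (Sum.inr b)) := by
      rw [TensorProduct.smul_tmul', smul_eq_mul, neg_mul, Complex.I_mul_I, neg_neg]
    rw [h]
    module

/-- The components `H^{ijk}` of the three-form `H`, regarded as a three-vector by means of the
metric, in the complex frame associated to the orthonormal frame `e`: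
`∑ H(e_μ, e_ν, e_κ) e_μ ⊗ e_ν ⊗ e_κ = ∑ H^{ijk} E_i ⊗ E_j ⊗ E_k`. -/
def components {x : M} (e : OrthonormalBasis (Fin n ⊕ Fin n) ℝ (TangentSpace 𝓘(ℝ, E) x))
    (H : TangentSpace 𝓘(ℝ, E) x [⋀^Fin 3]→ₗ[ℝ] ℂ) (i j k : Fin n ⊕ Fin n) : ℂ :=
  ∑ μ, ∑ ν, ∑ κ, H ![e μ, e ν, e κ] * frameCoeff μ i * frameCoeff ν j * frameCoeff κ k

/-- The element
`H^{i a_{n-1} a_n} ε_{a_1 … a_n} γ^{a_1 … a_{n-2}} (1 - (-1)^n w γ^*) ⊗ E_i` of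
`End(S_x) ⊗ (T_x M ⊗ ℂ)`: the sum over the `a_*` is over the unbarred indices, i.e. over
`(a_1, …, a_n) = (σ 1, …, σ n)` for permutations `σ`, and the one over `i` is over all indices;
`γ^{a_1 … a_k}` is the antisymmetrised product of the `γ^a = γ(E_a)`. -/
def SpinorBundle.obstruction (B : SpinorBundle n E M F S) (hn : 2 ≤ n) {x : M}
    (e : OrthonormalBasis (Fin n ⊕ Fin n) ℝ (TangentSpace 𝓘(ℝ, E) x))
    (H : TangentSpace 𝓘(ℝ, E) x [⋀^Fin 3]→ₗ[ℝ] ℂ) (gammaStar : Module.End ℂ (S x)) (w : ℂ) :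
    Module.End ℂ (S x) ⊗[ℂ] (ℂ ⊗[ℝ] TangentSpace 𝓘(ℝ, E) x) :=
  ∑ i, ∑ σ : Equiv.Perm (Fin n),
    ((components e H i (Sum.inl (σ ⟨n - 2, by omega⟩)) (Sum.inl (σ ⟨n - 1, by omega⟩)) *
        ((Equiv.Perm.sign σ : ℤ) : ℂ)) •
      (antisymmProd (fun j : Fin (n - 2) ↦
          B.γC x (complexFrame e (Sum.inl (σ (Fin.castLE (Nat.sub_le n 2) j))))) *
        (1 - ((-1) ^ n * w) • gammaStar))) ⊗ₜ[ℂ] complexFrame e i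

end SpinorTorsion
end

/-! Everything is pointwise. The operators `γ^{νκ}` are skew for the charge adjoint, so `𝒜^C = -𝒜`
and `D^C = D`. As `γ` is parallel for `∇`, `D̂γ` is the commutator of `𝒜` with Clifford
multiplication, and the torsion is `𝒯(X, Y) = 8 ∑ F(X, Y, e_κ) γ^κ` (`torsion_threeFormPotential`).
Hence the `e_ν` coefficient of `𝔇(𝒯; η, η)` is `16 ∑ F_{μνκ} γ^μ η ∧ γ^κ η`. The barred vectors
annihilate the pure spinor, so `γ^μ η` is a combination of the `γ^a η`, and only the components
`F^{iab}` with unbarred `a`, `b` enter (`sum_wedge_eq_zero`). It remains to show that these vanish.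

The `E_i` form a basis, so the condition says `Θ_i (1 - (-1)^n w γ^*) = 0` for each `i`, where `Θ_i
= ∑ F^{i a_{n-1} a_n} ε γ^{a_1 … a_{n-2}}`. On spinors of chirality `-(-1)^n w` the right factor is
`2`, so `Θ_i` kills them. For odd `n` this covers `γ^c γ^d η`. For even `n` it covers `γ^d η`, and
`Θ_i` commutes with `γ^c`. In both cases `Θ_i γ^c γ^d η = 0`. The `γ^a` anticommute, so only
`{a_{n-1}, a_n} = {c, d}` survives, and the left side is a nonzero multiple of `F^{icd} γ^1 ⋯ γ^n η`
(`eq_zero_of_sum_perm_smul_prod_apply`). The barred vectors act as annihilation operators with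
vacuum `η`, so `γ^1 ⋯ γ^n η ≠ 0` and `F^{icd} = 0` (`components_eq_zero_of_obstruction`). -/

noncomputable section

namespace SpinorTorsion

/-! ### Products of anticommuting operators. -/

section Algebra

variable {ι V : Type*} [AddCommGroup V] [Module ℂ V]

/-- Moving an operator past a product of operators with which it anticommutes. -/
theorem mul_prod_map_of_anticomm {A : Module.End ℂ V} {g : ι → Module.End ℂ V} (l : List ι)
    (h : ∀ b ∈ l, A * g b = -(g b * A)) :
    A * (l.map g).prod = ((-1 : ℂ) ^ l.length) • ((l.map g).prod * A) := by
  induction l with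
  | nil => simp
  | cons b l ih =>
    have ih := ih fun c hc ↦ h c (List.mem_cons_of_mem _ hc)
    rw [List.map_cons, List.prod_cons, ← mul_assoc, h b List.mem_cons_self, neg_mul, mul_assoc, ih,
      mul_smul_comm, List.length_cons, pow_succ, mul_assoc, mul_neg, mul_one, neg_smul]

/-- A member of a nodup list of pairwise anticommuting operators moves past their product with one
sign less. -/
theorem mul_prod_map_of_mem {g : ι → Module.End ℂ V}
    (h : ∀ a b, a ≠ b → g a * g b = -(g b * g a)) {l : List ι} (hl : l.Nodup) {a : ι}
    (ha : a ∈ l) :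
    g a * (l.map g).prod = ((-1 : ℂ) ^ (l.length + 1)) • ((l.map g).prod * g a) := by
  induction l with
  | nil => simp at ha
  | cons b l ih =>
    rw [List.nodup_cons] at hl
    rw [List.map_cons, List.prod_cons, List.length_cons]
    by_cases hab : a = b
    · subst hab
      -- The factor equal to `g a` costs no sign: the exponent `l.length + 2` has the parity of
      -- `l.length`.
      rw [mul_assoc, mul_prod_map_of_anticomm l fun c hc ↦ h a c (by grind), mul_smul_comm,
        pow_succ, pow_succ, mul_assoc ((-1 : ℂ) ^ _), neg_one_mul, neg_neg, mul_one]
    · rw [← mul_assoc, h a b hab, neg_mul, mul_assoc, ih hl.2 (by grind), mul_smul_comm,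
        pow_succ _ (l.length + 1), mul_assoc, mul_neg, mul_one, neg_smul]

/-- The square of a product of anticommuting operators with square `-1`. -/
theorem prod_map_mul_self {g : ι → Module.End ℂ V}
    (h : ∀ a b, a ≠ b → g a * g b = -(g b * g a)) (h1 : ∀ a, g a * g a = -1) {l : List ι}
    (hl : l.Nodup) :
    (l.map g).prod * (l.map g).prod =
      ((-1 : ℂ) ^ (∑ i ∈ Finset.range (l.length + 1), i)) • (1 : Module.End ℂ V) := by
  induction l with
  | nil => simp
  | cons b l ih =>
    rw [List.nodup_cons] at hl
    have hb := mul_prod_map_of_anticomm (A := g b) (g := g) l fun c hc ↦ h b c (by grind)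
    rw [List.map_cons, List.prod_cons]
    calc g b * (l.map g).prod * (g b * (l.map g).prod)
        = ((-1 : ℂ) ^ l.length) • ((-1 : ℂ) ^ l.length) •
            (g b * ((l.map g).prod * g b) * (l.map g).prod) := by
          rw [smul_smul, ← pow_add, Even.neg_one_pow (by simp), one_smul]
          simp only [mul_assoc]
      _ = ((-1 : ℂ) ^ l.length) • (g b * g b * ((l.map g).prod * (l.map g).prod)) := by
          congr 1
          rw [← smul_mul_assoc, ← mul_smul_comm, ← hb]
          simp only [mul_assoc]
      _ = _ := by
          rw [h1, ih hl.2, List.length_cons, Finset.sum_range_succ _ (l.length + 1), pow_add,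
            pow_succ, neg_one_mul, smul_neg, smul_smul, ← neg_smul]
          congr 1
          ring

/-- Products of creation operators do not annihilate the vacuum. -/
theorem prod_map_apply_ne_zero [DecidableEq ι] {g h : ι → Module.End ℂ V} {c : ℂ} (hc : c ≠ 0)
    (hgh : ∀ a b, h a * g b + g b * h a = if a = b then c • 1 else 0) {η : V} (hη : η ≠ 0)
    (hh : ∀ a, h a η = 0) {l : List ι} (hl : l.Nodup) : (l.map g).prod η ≠ 0 := by
  induction l with
  | nil => simpa
  | cons a l ih =>
    rw [List.nodup_cons] at hl
    have hz : h a ((l.map g).prod η) = 0 := by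
      have := mul_prod_map_of_anticomm (A := h a) (g := g) l fun b hb ↦ by
        have := hgh a b
        rw [if_neg (by grind)] at this
        exact eq_neg_of_add_eq_zero_left this
      rw [← Module.End.mul_apply, this]
      simp [hh]
    -- Evaluating `h a * g a + g a * h a = c` on the shorter product leaves `c` times that product,
    -- since both terms on the left vanish.
    intro h0
    have h1 := congr($(hgh a a) ((l.map g).prod η))
    rw [List.map_cons, List.prod_cons, Module.End.mul_apply] at h0
    simp only [LinearMap.add_apply, Module.End.mul_apply, h0, hz, map_zero, add_zero, if_true,
      LinearMap.smul_apply, Module.End.one_apply] at h1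
    exact ih hl.2 ((smul_eq_zero.1 h1.symm).resolve_left hc)

variable {n : ℕ} {g : Fin n → Module.End ℂ V}

/-- Products of operators satisfying the relations of an exterior algebra depend on the factors
in an alternating way. -/
theorem exists_alternatingMap_eq_prod (hg : ∀ a b, g a * g b = -(g b * g a)) (k : ℕ) :
    ∃ Φ : (Fin n → ℂ) [⋀^Fin k]→ₗ[ℂ] Module.End ℂ V, ∀ u : Fin k → Fin n,
      Φ (fun j ↦ Pi.single (u j) 1) = (List.ofFn fun j ↦ g (u j)).prod := by
  let f : (Fin n → ℂ) →ₗ[ℂ] Module.End ℂ V := Fintype.linearCombination ℂ g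
  -- Vanishing squares let `f` extend to the exterior algebra, where products of vectors are
  -- alternating.
  have hf : ∀ v, f v * f v = 0 := fun v ↦ by
    have h : f v * f v = -(f v * f v) := by
      simp only [f, Fintype.linearCombination_apply, Finset.sum_mul, Finset.mul_sum,
        smul_mul_smul_comm]
      conv_lhs => rw [Finset.sum_comm]
      simp only [← Finset.sum_neg_distrib]
      refine Finset.sum_congr rfl fun a _ ↦ Finset.sum_congr rfl fun b _ ↦ ?_
      rw [hg b a, mul_comm, smul_neg, neg_neg]
    have h2 : (2 : ℂ) • (f v * f v) = 0 := by
      rw [two_smul]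
      nth_rewrite 1 [h]
      exact neg_add_cancel _
    exact (smul_eq_zero.1 h2).resolve_left two_ne_zero
  refine ⟨(ExteriorAlgebra.lift ℂ ⟨f, hf⟩).toLinearMap.compAlternatingMap
    (ExteriorAlgebra.ιMulti ℂ k), fun u ↦ ?_⟩
  simp [ExteriorAlgebra.ιMulti_apply, map_list_prod, List.map_ofFn, Function.comp_def, f]

theorem prod_ofFn_perm (hg : ∀ a b, g a * g b = -(g b * g a)) {k : ℕ} (u : Fin k → Fin n)
    (σ : Equiv.Perm (Fin k)) :
    (List.ofFn fun j ↦ g (u (σ j))).prod =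
      ((Equiv.Perm.sign σ : ℤ) : ℂ) • (List.ofFn fun j ↦ g (u j)).prod := by
  obtain ⟨Φ, hΦ⟩ := exists_alternatingMap_eq_prod hg k
  rw [← hΦ u, ← hΦ fun j ↦ u (σ j), Int.cast_smul_eq_zsmul]
  exact Φ.map_perm (fun j ↦ Pi.single (u j) 1) σ

theorem prod_ofFn_eq_zero (hg : ∀ a b, g a * g b = -(g b * g a)) {k : ℕ} {u : Fin k → Fin n}
    {i j : Fin k} (hij : i ≠ j) (hu : u i = u j) : (List.ofFn fun j ↦ g (u j)).prod = 0 := by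
  obtain ⟨Φ, hΦ⟩ := exists_alternatingMap_eq_prod hg k
  rw [← hΦ u]
  exact Φ.map_eq_zero_of_eq _ (by simp [hu]) hij

/-- Reordering the factors produces a second `sign σ`, which cancels the first; the `k!` equal terms
then cancel the normalisation. -/
theorem antisymmProd_eq_prod (hg : ∀ a b, g a * g b = -(g b * g a)) {k : ℕ}
    (u : Fin k → Fin n) :
    antisymmProd (fun j ↦ g (u j)) = (List.ofFn fun j ↦ g (u j)).prod := by
  have h (σ : Equiv.Perm (Fin k)) : ((Equiv.Perm.sign σ : ℤ) : ℂ) * ((Equiv.Perm.sign σ : ℤ) : ℂ)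
      = 1 := by
    rcases Int.units_eq_one_or (Equiv.Perm.sign σ) with h | h <;> simp [h]
  simp only [antisymmProd, prod_ofFn_perm hg, smul_smul, h, one_smul, Finset.sum_const,
    Finset.card_univ, Fintype.card_perm, Fintype.card_fin]
  rw [← Nat.cast_smul_eq_nsmul ℂ, smul_smul, inv_mul_cancel₀ (Nat.cast_ne_zero.2 k.factorial_ne_zero), one_smul]

/-- A skew-symmetric array is determined by its contraction with complementary products of
creation operators. -/
theorem eq_zero_of_sum_perm_smul_prod_apply {m : ℕ} {g : Fin (m + 2) → Module.End ℂ V}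
    (hg : ∀ a b, g a * g b = -(g b * g a)) {η : V}
    (hη : (List.ofFn g).prod η ≠ 0) {G : Fin (m + 2) → Fin (m + 2) → ℂ}
    (hG : ∀ a b, G a b = -G b a) (c d : Fin (m + 2))
    (h : ∑ σ : Equiv.Perm (Fin (m + 2)),
      (G (σ (Fin.last m).castSucc) (σ (Fin.last (m + 1))) * ((Equiv.Perm.sign σ : ℤ) : ℂ)) •
        (List.ofFn fun j : Fin m ↦ g (σ j.castSucc.castSucc)).prod (g c (g d η)) = 0) :
    G c d = 0 := by
  by_cases hcd : c = d
  · subst hcd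
    exact self_eq_neg.1 (hG c c)
  have hsign (σ : Equiv.Perm (Fin (m + 2))) :
      ((Equiv.Perm.sign σ : ℤ) : ℂ) * ((Equiv.Perm.sign σ : ℤ) : ℂ) = 1 := by
    rcases Int.units_eq_one_or (Equiv.Perm.sign σ) with h | h <;> simp [h]
  -- The index word of the full product applied to `η`: the first `m` values of `σ`, followed by `c`
  -- and `d`.
  let u (σ : Equiv.Perm (Fin (m + 2))) : Fin (m + 2) → Fin (m + 2) :=
    Fin.snoc (α := fun _ ↦ Fin (m + 2)) (Fin.snoc (α := fun _ ↦ Fin (m + 2))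
      (fun j : Fin m ↦ σ j.castSucc.castSucc) c) d
  have hu0 σ (j : Fin m) : u σ j.castSucc.castSucc = σ j.castSucc.castSucc := by simp [u]
  have hu1 σ : u σ (Fin.last m).castSucc = c := by simp [u]
  have hu2 σ : u σ (Fin.last (m + 1)) = d := by simp [u]
  have hprod σ : (List.ofFn fun j : Fin m ↦ g (σ j.castSucc.castSucc)).prod (g c (g d η)) =
      (List.ofFn fun j ↦ g (u σ j)).prod η := by
    rw [List.ofFn_succ', List.ofFn_succ']
    simp [hu0, hu1, hu2]
  let p (σ : Equiv.Perm (Fin (m + 2))) : Prop :=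
    (σ (Fin.last m).castSucc = c ∧ σ (Fin.last (m + 1)) = d) ∨
      (σ (Fin.last m).castSucc = d ∧ σ (Fin.last (m + 1)) = c)
  classical
  have hterm (σ : Equiv.Perm (Fin (m + 2))) :
      (G (σ (Fin.last m).castSucc) (σ (Fin.last (m + 1))) * ((Equiv.Perm.sign σ : ℤ) : ℂ)) •
        (List.ofFn fun j : Fin m ↦ g (σ j.castSucc.castSucc)).prod (g c (g d η)) =
      if p σ then G c d • (List.ofFn g).prod η else 0 := by
    rw [hprod]
    split_ifs with hp
    · rcases hp with ⟨h1, h2⟩ | ⟨h1, h2⟩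
      · have : u σ = σ := by
          ext1 j
          induction j using Fin.lastCases with
          | last => rw [hu2, h2]
          | cast j =>
            induction j using Fin.lastCases with
            | last => rw [hu1, h1]
            | cast j => rw [hu0]
        rw [this, prod_ofFn_perm hg (fun j ↦ j) σ, LinearMap.smul_apply, smul_smul, mul_assoc,
          hsign, mul_one, h1, h2]
      -- The sign of the transposition cancels that of `G d c = -G c d`, so this case contributes
      -- the same term as the previous one.
      · have : u σ = ⇑(σ * Equiv.swap (Fin.last m).castSucc (Fin.last (m + 1))) := by
          ext1 j
          induction j using Fin.lastCases with
          | last => simp [hu2, h1]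
          | cast j =>
            induction j using Fin.lastCases with
            | last => simp [hu1, h2]
            | cast j =>
              rw [hu0, Equiv.Perm.mul_apply, Equiv.swap_apply_of_ne_of_ne]
              · simp [Fin.ext_iff, j.2.ne]
              · simp [Fin.ext_iff]; omega
        rw [this, prod_ofFn_perm hg (fun j ↦ j), LinearMap.smul_apply, smul_smul, mul_assoc,
          Equiv.Perm.sign_mul, Equiv.Perm.sign_swap (by simp [Fin.ext_iff]), h1, h2, hG d c]
        congr 1
        push_cast
        linear_combination (G c d) * hsign σ
    · have hc : σ (σ.symm c) = c := σ.apply_symm_apply c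
      have hd : σ (σ.symm d) = d := σ.apply_symm_apply d
      -- Otherwise `c` or `d` is already among the first `m` values of `σ`, so the word `u σ` has a
      -- repeated letter.
      have key : (List.ofFn fun j ↦ g (u σ j)).prod = 0 := by
        generalize σ.symm c = i at hc
        generalize σ.symm d = j at hd
        induction i using Fin.lastCases with
        | last =>
          induction j using Fin.lastCases with
          | last => exact absurd (hc.symm.trans hd) hcd
          | cast j =>
            induction j using Fin.lastCases with
            | last => exact absurd (Or.inr ⟨hd, hc⟩) hp
            | cast j =>
              exact prod_ofFn_eq_zero hg (Fin.castSucc_lt_last _).ne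
                ((hu0 σ j).trans (hd.trans (hu2 σ).symm))
        | cast i =>
          induction i using Fin.lastCases with
          | last =>
            induction j using Fin.lastCases with
            | last => exact absurd (Or.inl ⟨hc, hd⟩) hp
            | cast j =>
              induction j using Fin.lastCases with
              | last => exact absurd (hc.symm.trans hd) hcd
              | cast j =>
                exact prod_ofFn_eq_zero hg (Fin.castSucc_lt_last _).ne
                  ((hu0 σ j).trans (hd.trans (hu2 σ).symm))
          | cast i =>
            exact prod_ofFn_eq_zero hg
              ((Fin.castSucc_injective _).ne (Fin.castSucc_lt_last i).ne)
              ((hu0 σ i).trans (hc.trans (hu1 σ).symm))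
      rw [key, LinearMap.zero_apply, smul_zero]
  rw [Finset.sum_congr rfl fun σ _ ↦ hterm σ, ← Finset.sum_filter, Finset.sum_const,
    ← Nat.cast_smul_eq_nsmul ℂ] at h
  refine ((smul_eq_zero.1 ((smul_eq_zero.1 h).resolve_left ?_)).resolve_right hη)
  -- The sum is the number of surviving permutations times `G c d • (List.ofFn g).prod η`; one such
  -- permutation suffices to cancel that number.
  obtain ⟨σ, hσ1, hσ2⟩ : ∃ σ : Equiv.Perm (Fin (m + 2)),
      σ (Fin.last m).castSucc = c ∧ σ (Fin.last (m + 1)) = d := by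
    have hne : (Fin.last m).castSucc ≠ Fin.last (m + 1) := (Fin.castSucc_lt_last _).ne
    refine ⟨Equiv.swap d (Equiv.swap (Fin.last m).castSucc c (Fin.last (m + 1))) *
      Equiv.swap (Fin.last m).castSucc c, ?_, ?_⟩
    · rw [Equiv.Perm.mul_apply, Equiv.swap_apply_left, Equiv.swap_apply_of_ne_of_ne hcd]
      exact fun h ↦ hne ((Equiv.swap _ _).injective ((Equiv.swap_apply_left _ _).trans h))
    · simp
  exact Nat.cast_ne_zero.2 (Finset.card_ne_zero_of_mem (Finset.mem_filter.2
    ⟨Finset.mem_univ σ, Or.inl ⟨hσ1, hσ2⟩⟩))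

end Algebra

/-! ### Metric contractions and three-forms. -/

section InnerProduct

variable {W : Type*} [NormedAddCommGroup W] [InnerProductSpace ℝ W]
  {N : Type*} [AddCommGroup N] [Module ℝ N]

/-- The metric contraction of a bilinear map can be computed in any orthonormal basis. -/
theorem sum_orthonormalBasis_eq {ι κ : Type*} [Fintype ι] [Fintype κ]
    (b : W →ₗ[ℝ] W →ₗ[ℝ] N) (f : OrthonormalBasis ι ℝ W) (e : OrthonormalBasis κ ℝ W) :
    ∑ i, b (f i) (f i) = ∑ j, b (e j) (e j) := by
  calc ∑ i, b (f i) (f i) = ∑ i, ∑ j, inner ℝ (e j) (f i) • b (e j) (f i) := by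
        refine Finset.sum_congr rfl fun i _ ↦ ?_
        conv_lhs => enter [1]; rw [← e.sum_repr' (f i)]
        simp
    _ = ∑ j, b (e j) (∑ i, inner ℝ (f i) (e j) • f i) := by
        rw [Finset.sum_comm]
        simp [real_inner_comm]
    _ = _ := by simp only [f.sum_repr']

theorem threeForm_swap_left (H : W [⋀^Fin 3]→ₗ[ℝ] ℂ) (X Y Z : W) :
    H ![Y, X, Z] = -H ![X, Y, Z] := by
  rw [← H.map_swap ![X, Y, Z] (show (0 : Fin 3) ≠ 1 by decide)]
  congr 1
  ext i
  fin_cases i <;> rfl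

theorem threeForm_swap_right (H : W [⋀^Fin 3]→ₗ[ℝ] ℂ) (X Y Z : W) :
    H ![X, Z, Y] = -H ![X, Y, Z] := by
  rw [← H.map_swap ![X, Y, Z] (show (1 : Fin 3) ≠ 2 by decide)]
  congr 1
  ext i
  fin_cases i <;> rfl

/-- A three-form as a trilinear map. -/
def threeFormTrilinear (H : W [⋀^Fin 3]→ₗ[ℝ] ℂ) : W →ₗ[ℝ] W →ₗ[ℝ] W →ₗ[ℝ] ℂ where
  toFun X := LinearMap.mk₂ ℝ (fun Y Z ↦ H ![X, Y, Z])
    (fun Y Y' Z ↦ by simpa using (H.curryLeft X).map_vecCons_add ![Z] Y Y')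
    (fun c Y Z ↦ by simpa using (H.curryLeft X).map_vecCons_smul ![Z] c Y)
    (fun Y Z Z' ↦ by simpa using ((H.curryLeft X).curryLeft Y).map_vecCons_add ![] Z Z')
    (fun c Y Z ↦ by simpa using ((H.curryLeft X).curryLeft Y).map_vecCons_smul ![] c Z)
  map_add' X X' := by
    ext Y Z
    exact H.map_vecCons_add ![Y, Z] X X'
  map_smul' c X := by
    ext Y Z
    exact H.map_vecCons_smul ![Y, Z] c X

@[simp]
theorem threeFormTrilinear_apply (H : W [⋀^Fin 3]→ₗ[ℝ] ℂ) (X Y Z : W) :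
    threeFormTrilinear H X Y Z = H ![X, Y, Z] := rfl

end InnerProduct

/-! ### Commutators with Clifford multiplication. -/

section Clifford

variable {W : Type*} [NormedAddCommGroup W] [InnerProductSpace ℝ W]
  {V : Type*} [AddCommGroup V] [Module ℂ V] {γ : W →ₗ[ℝ] Module.End ℂ V}

theorem antisymmProd_two (a b : Module.End ℂ V) :
    antisymmProd ![a, b] = (1 / 2 : ℂ) • (a * b - b * a) := by
  have h : (Finset.univ : Finset (Equiv.Perm (Fin 2))) = {1, Equiv.swap 0 1} := by decide
  rw [antisymmProd, h, Finset.sum_pair (by decide)]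
  simp [sub_eq_add_neg]

/-- The commutator of `γ^{uv}` with Clifford multiplication. -/
theorem antisymmProd_two_commutator
    (hγ : ∀ X Y, γ X * γ Y + γ Y * γ X = (-2 * inner ℝ X Y : ℝ) • (1 : Module.End ℂ V))
    (u v Y : W) :
    antisymmProd ![γ u, γ v] * γ Y - γ Y * antisymmProd ![γ u, γ v] =
      (2 : ℝ) • (inner ℝ u Y • γ v - inner ℝ v Y • γ u) := by
  have h1 : γ v * γ Y = (-2 * inner ℝ v Y : ℝ) • 1 - γ Y * γ v := eq_sub_of_add_eq (hγ v Y)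
  have h2 : γ u * γ Y = (-2 * inner ℝ u Y : ℝ) • 1 - γ Y * γ u := eq_sub_of_add_eq (hγ u Y)
  have h3 : γ u * γ v * γ Y = (-2 * inner ℝ v Y : ℝ) • γ u - (-2 * inner ℝ u Y : ℝ) • γ v
      + γ Y * (γ u * γ v) := by
    rw [mul_assoc, h1, mul_sub, ← mul_assoc, h2, sub_mul, mul_smul_comm, smul_mul_assoc, mul_one,
      one_mul, mul_assoc]
    abel
  have h4 : γ v * γ u * γ Y = (-2 * inner ℝ u Y : ℝ) • γ v - (-2 * inner ℝ v Y : ℝ) • γ u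
      + γ Y * (γ v * γ u) := by
    rw [mul_assoc, h2, mul_sub, ← mul_assoc, h1, sub_mul, mul_smul_comm, smul_mul_assoc, mul_one,
      one_mul, mul_assoc]
    abel
  rw [antisymmProd_two, smul_mul_assoc, mul_smul_comm, sub_mul, mul_sub, h3, h4]
  simp only [← Complex.coe_smul]
  push_cast
  module

/-- Each commutator contributes two contractions with `Y`; by skew-symmetry of `H` they agree, which
turns the factor `2` into `4`. -/
theorem sum_smul_antisymmProd_commutator {ι : Type*} [Fintype ι]
    (hγ : ∀ X Y, γ X * γ Y + γ Y * γ X = (-2 * inner ℝ X Y : ℝ) • (1 : Module.End ℂ V))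
    (f : OrthonormalBasis ι ℝ W) (H : W [⋀^Fin 3]→ₗ[ℝ] ℂ) (X Y : W) :
    (∑ i, ∑ j, H ![X, f i, f j] • antisymmProd ![γ (f i), γ (f j)]) * γ Y -
      γ Y * (∑ i, ∑ j, H ![X, f i, f j] • antisymmProd ![γ (f i), γ (f j)]) =
    (4 : ℂ) • ∑ j, H ![X, Y, f j] • γ (f j) := by
  have hl (Z : W) : ∑ i, inner ℝ (f i) Y • H ![X, f i, Z] = H ![X, Y, Z] := by
    have := congr(threeFormTrilinear H X $(f.sum_repr' Y) Z)
    simpa using this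
  have hr (Z : W) : ∑ i, inner ℝ (f i) Y • H ![X, Z, f i] = H ![X, Z, Y] := by
    have := congr(threeFormTrilinear H X Z $(f.sum_repr' Y))
    simpa using this
  calc _ = ∑ i, ∑ j, H ![X, f i, f j] • ((2 : ℝ) • (inner ℝ (f i) Y • γ (f j) -
        inner ℝ (f j) Y • γ (f i))) := by
        simp only [Finset.sum_mul, Finset.mul_sum, ← Finset.sum_sub_distrib, smul_mul_assoc,
          mul_smul_comm, ← smul_sub, antisymmProd_two_commutator hγ]
    _ = (2 : ℂ) • ((∑ j, (∑ i, inner ℝ (f i) Y • H ![X, f i, f j]) • γ (f j)) -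
        ∑ i, (∑ j, inner ℝ (f j) Y • H ![X, f i, f j]) • γ (f i)) := by
        simp only [Finset.sum_smul, smul_sub, Finset.smul_sum, Finset.sum_sub_distrib]
        congr 1
        · rw [Finset.sum_comm]
          refine Finset.sum_congr rfl fun i _ ↦ Finset.sum_congr rfl fun j _ ↦ ?_
          simp only [← Complex.coe_smul, smul_smul]
          congr 1
          push_cast
          simp
          ring
        · refine Finset.sum_congr rfl fun i _ ↦ Finset.sum_congr rfl fun j _ ↦ ?_
          simp only [← Complex.coe_smul, smul_smul]
          congr 1
          push_cast
          simp
          ring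
    _ = _ := by
        simp only [hl, hr]
        simp only [threeForm_swap_right H X Y, neg_smul, Finset.sum_neg_distrib]
        module

end Clifford

variable {n : ℕ} {E : Type*} [NormedAddCommGroup E] [NormedSpace ℝ E] [FiniteDimensional ℝ E]
  {M : Type*} [TopologicalSpace M] [ChartedSpace E M] [IsManifold 𝓘(ℝ, E) ∞ M]
  [RiemannianBundle (fun x : M ↦ TangentSpace 𝓘(ℝ, E) x)]
  {F : Type*} [NormedAddCommGroup F] [NormedSpace ℂ F]
  {S : M → Type*} [TopologicalSpace (TotalSpace F S)]
  [∀ x, AddCommGroup (S x)] [∀ x, Module ℂ (S x)] [∀ x, TopologicalSpace (S x)]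
  [FiberBundle F S]

/-! ### Charge adjoints, chirality, and the Clifford relations of the complex frame. -/

namespace SpinorBundle

variable (B : SpinorBundle n E M F S)

/-- Moving two Clifford factors across `C` reverses their order, and the signs `Δ₀ Δ₁` occur
squared. -/
theorem chargeAdj_antisymmProd_two {x : M} (u v : TangentSpace 𝓘(ℝ, E) x) :
    B.chargeAdj x (antisymmProd ![B.γ x u, B.γ x v]) = -antisymmProd ![B.γ x u, B.γ x v] := by
  have h0 : ((B.Δ₀ : ℤ) : ℂ) * ((B.Δ₀ : ℤ) : ℂ) = 1 := by
    rcases Int.units_eq_one_or B.Δ₀ with h | h <;> simp [h]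
  have h1 : ((B.Δ₁ : ℤ) : ℂ) * ((B.Δ₁ : ℤ) : ℂ) = 1 := by
    rcases Int.units_eq_one_or B.Δ₁ with h | h <;> simp [h]
  have hγ (X : TangentSpace 𝓘(ℝ, E) x) (φ ψ : S x) : B.C x φ (B.γ x X ψ) =
      ((B.Δ₁ : ℤ) : ℂ) * ((B.Δ₀ : ℤ) : ℂ) * B.C x (B.γ x X φ) ψ := by
    rw [B.symm_C_γ, B.symm_C x ψ, mul_assoc]
  refine B.chargeAdj_eq fun φ ψ ↦ ?_
  have h2 (X Y : TangentSpace 𝓘(ℝ, E) x) :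
      B.C x φ (B.γ x X (B.γ x Y ψ)) = B.C x (B.γ x Y (B.γ x X φ)) ψ := by
    rw [hγ, hγ, ← mul_assoc]
    linear_combination (B.C x (B.γ x Y (B.γ x X φ)) ψ) * (((B.Δ₀ : ℤ) : ℂ) * ((B.Δ₀ : ℤ) : ℂ) * h1
      + h0)
  simp only [antisymmProd_two, LinearMap.neg_apply, LinearMap.smul_apply, LinearMap.sub_apply,
    Module.End.mul_apply, map_neg, map_smul, map_sub, h2]
  simp only [smul_eq_mul]
  ring

/-- This makes `D^C = D`, so that `D̂γ` becomes a commutator. -/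
theorem chargeAdj_threeFormPotential (H : ∀ x : M, TangentSpace 𝓘(ℝ, E) x [⋀^Fin 3]→ₗ[ℝ] ℂ)
    {x : M} (v : TangentSpace 𝓘(ℝ, E) x) :
    B.chargeAdj x (B.threeFormPotential H x v) = -B.threeFormPotential H x v := by
  refine B.chargeAdj_eq fun φ ψ ↦ ?_
  simp only [threeFormPotential, LinearMap.coe_mk, AddHom.coe_mk, LinearMap.neg_apply,
    LinearMap.sum_apply, map_sum, LinearMap.smul_apply, map_smul, map_neg, ← C_chargeAdj,
    chargeAdj_antisymmProd_two, Finset.sum_neg_distrib, smul_neg]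

/-- The product of all `γ(f_μ)` squares to `(-1)^(n(2n+1)) = (-1)^n`; the factor `i` for odd `n`
corrects the sign. -/
theorem gammaStar_mul_self {x : M}
    (f : OrthonormalBasis (Fin (2 * n)) ℝ (TangentSpace 𝓘(ℝ, E) x)) :
    B.gammaStar f * B.gammaStar f = 1 := by
  have h1 (a) : B.γ x (f a) * B.γ x (f a) = -1 := by
    have h := B.clifford x (f a) (f a)
    rw [← two_smul ℂ, real_inner_self_eq_norm_sq, f.norm_eq_one, ← Complex.coe_smul] at h
    refine smul_right_injective _ (two_ne_zero (α := ℂ)) (h.trans ?_)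
    simp
  have h (a b) (hab : a ≠ b) : B.γ x (f a) * B.γ x (f b) = -(B.γ x (f b) * B.γ x (f a)) := by
    have h := B.clifford x (f a) (f b)
    rw [f.inner_eq_zero hab, mul_zero, zero_smul] at h
    exact eq_neg_of_add_eq_zero_left h
  have hsq := prod_map_mul_self (g := fun μ ↦ B.γ x (f μ)) h h1 (List.nodup_finRange (2 * n))
  have hp : (∑ i ∈ Finset.range (2 * n + 1), i) = n * (2 * n + 1) := by
    have := Finset.sum_range_id_mul_two (2 * n + 1)
    rw [Nat.add_sub_cancel] at this
    linarith
  rw [← List.ofFn_eq_map, List.length_finRange, hp] at hsq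
  rw [gammaStar, smul_mul_smul_comm, hsq, smul_smul]
  rcases n.even_or_odd with hn | hn
  · simp [hn, hn.mul_right]
  · have : Odd (n * (2 * n + 1)) := hn.mul (by simp)
    simp [Nat.not_even_iff_odd.2 hn, this.neg_one_pow]

/-- A frame vector anticommutes with every factor of `γ^*` except itself, giving `2n - 1` signs; the
general case follows by linearity. -/
theorem gammaStar_mul_γ {x : M}
    (f : OrthonormalBasis (Fin (2 * n)) ℝ (TangentSpace 𝓘(ℝ, E) x))
    (X : TangentSpace 𝓘(ℝ, E) x) : B.gammaStar f * B.γ x X = -(B.γ x X * B.gammaStar f) := by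
  have h (a b) (hab : a ≠ b) : B.γ x (f a) * B.γ x (f b) = -(B.γ x (f b) * B.γ x (f a)) := by
    have h := B.clifford x (f a) (f b)
    rw [f.inner_eq_zero hab, mul_zero, zero_smul] at h
    exact eq_neg_of_add_eq_zero_left h
  have key (a) : B.gammaStar f * B.γ x (f a) = -(B.γ x (f a) * B.gammaStar f) := by
    have := mul_prod_map_of_mem (g := fun μ ↦ B.γ x (f μ)) h (List.nodup_finRange (2 * n))
      (List.mem_finRange a)
    rw [← List.ofFn_eq_map, List.length_finRange, Odd.neg_one_pow (by simp), neg_one_smul] at this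
    rw [gammaStar, mul_smul_comm, this, smul_mul_assoc, smul_neg, neg_neg]
  rw [← f.sum_repr' X]
  simp only [map_sum, map_smul, Finset.mul_sum, Finset.sum_mul, ← Finset.sum_neg_distrib,
    mul_smul_comm, smul_mul_assoc, key, smul_neg]

theorem γC_tmul (x : M) (c : ℂ) (X : TangentSpace 𝓘(ℝ, E) x) :
    B.γC x (c ⊗ₜ X) = c • B.γ x X := by
  simp [γC]

theorem γC_complexFrame_inl {x : M} (e : Fin n ⊕ Fin n → TangentSpace 𝓘(ℝ, E) x) (a : Fin n) :
    B.γC x (complexFrame e (Sum.inl a)) =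
      B.γ x (e (Sum.inl a)) + Complex.I • B.γ x (e (Sum.inr a)) := by
  simp [complexFrame, γC_tmul]

theorem γC_complexFrame_inr {x : M} (e : Fin n ⊕ Fin n → TangentSpace 𝓘(ℝ, E) x) (a : Fin n) :
    B.γC x (complexFrame e (Sum.inr a)) =
      B.γ x (e (Sum.inl a)) - Complex.I • B.γ x (e (Sum.inr a)) := by
  simp [complexFrame, γC_tmul]

theorem clifford_orthonormal {x : M}
    (e : OrthonormalBasis (Fin n ⊕ Fin n) ℝ (TangentSpace 𝓘(ℝ, E) x)) (i j : Fin n ⊕ Fin n) :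
    B.γ x (e i) * B.γ x (e j) + B.γ x (e j) * B.γ x (e i) =
      (if i = j then (-2 : ℂ) else 0) • (1 : Module.End ℂ (S x)) := by
  rw [B.clifford, e.inner_eq_ite, ← Complex.coe_smul]
  split_ifs <;> simp

/-- The unbarred vectors span an isotropic subspace for the complex bilinear extension of `g`. -/
theorem γC_unbarred_anticomm {x : M}
    (e : OrthonormalBasis (Fin n ⊕ Fin n) ℝ (TangentSpace 𝓘(ℝ, E) x)) (a b : Fin n) :
    B.γC x (complexFrame e (Sum.inl a)) * B.γC x (complexFrame e (Sum.inl b)) =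
      -(B.γC x (complexFrame e (Sum.inl b)) * B.γC x (complexFrame e (Sum.inl a))) := by
  have h11 := B.clifford_orthonormal e (.inl a) (.inl b)
  have h12 := B.clifford_orthonormal e (.inl a) (.inr b)
  have h21 := B.clifford_orthonormal e (.inr a) (.inl b)
  have h22 := B.clifford_orthonormal e (.inr a) (.inr b)
  simp only [Sum.inl.injEq, Sum.inr.injEq, reduceCtorEq, if_false, zero_smul] at h11 h12 h21 h22
  simp only [γC_complexFrame_inl, add_mul, mul_add, smul_mul_assoc, mul_smul_comm,
    smul_add, smul_smul, Complex.I_mul_I]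
  linear_combination (norm := module) h11 + Complex.I • h12 + Complex.I • h21 - h22

/-- Here `g(E_ā, E_b) = 2 δ_{ab}`. Up to scale these are the relations between annihilation and
creation operators. -/
theorem γC_barred_unbarred {x : M}
    (e : OrthonormalBasis (Fin n ⊕ Fin n) ℝ (TangentSpace 𝓘(ℝ, E) x)) (a b : Fin n) :
    B.γC x (complexFrame e (Sum.inr a)) * B.γC x (complexFrame e (Sum.inl b)) +
      B.γC x (complexFrame e (Sum.inl b)) * B.γC x (complexFrame e (Sum.inr a)) =
      if a = b then (-4 : ℂ) • 1 else 0 := by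
  have h11 := B.clifford_orthonormal e (.inl a) (.inl b)
  have h12 := B.clifford_orthonormal e (.inl a) (.inr b)
  have h21 := B.clifford_orthonormal e (.inr a) (.inl b)
  have h22 := B.clifford_orthonormal e (.inr a) (.inr b)
  simp only [Sum.inl.injEq, Sum.inr.injEq, reduceCtorEq, if_false, zero_smul] at h11 h12 h21 h22
  simp only [γC_complexFrame_inl, γC_complexFrame_inr, add_mul, mul_add, sub_mul, mul_sub,
    smul_mul_assoc, mul_smul_comm, smul_add, smul_sub, smul_smul, Complex.I_mul_I]
  trans (if a = b then (-4 : ℂ) else 0) • 1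
  · rw [show (if a = b then (-4 : ℂ) else 0) = 2 * (if a = b then (-2 : ℂ) else 0) by
      split_ifs <;> norm_num]
    linear_combination (norm := module) h11 + Complex.I • h12 - Complex.I • h21 + h22
  · split_ifs <;> simp

end SpinorBundle

/-! ### The complex frame as a basis, and components of three-forms. -/

theorem top_le_span_complexFrame {x : M}
    (e : OrthonormalBasis (Fin n ⊕ Fin n) ℝ (TangentSpace 𝓘(ℝ, E) x)) :
    ⊤ ≤ Submodule.span ℂ (Set.range (complexFrame e)) := by
  rw [← (Algebra.TensorProduct.basis ℂ e.toBasis).span_eq, Submodule.span_le]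
  rintro _ ⟨μ, rfl⟩
  rw [Algebra.TensorProduct.basis_apply, e.coe_toBasis, ← sum_frameCoeff]
  exact Submodule.sum_mem _ fun i _ ↦
    Submodule.smul_mem _ _ (Submodule.subset_span (Set.mem_range_self i))

theorem linearIndependent_complexFrame {x : M}
    (e : OrthonormalBasis (Fin n ⊕ Fin n) ℝ (TangentSpace 𝓘(ℝ, E) x)) :
    LinearIndependent ℂ (complexFrame e) :=
  linearIndependent_of_top_le_span_of_card_eq_finrank (top_le_span_complexFrame e)
    (Module.finrank_eq_card_basis (Algebra.TensorProduct.basis ℂ e.toBasis)).symm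

theorem eq_zero_of_sum_tmul_complexFrame {x : M}
    (e : OrthonormalBasis (Fin n ⊕ Fin n) ℝ (TangentSpace 𝓘(ℝ, E) x))
    {A : Type*} [AddCommGroup A] [Module ℂ A] {a : Fin n ⊕ Fin n → A}
    (h : ∑ i, a i ⊗ₜ[ℂ] complexFrame e i = 0) (i : Fin n ⊕ Fin n) : a i = 0 := by
  let b := Module.Basis.mk (linearIndependent_complexFrame e) (top_le_span_complexFrame e)
  have := TensorProduct.sum_tmul_basis_right_eq_zero b (Finsupp.equivFunOnFinite.symm a) (by
    rw [Finsupp.sum_fintype _ _ (by simp)]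
    simpa [b] using h)
  simpa using congr($this i)

theorem components_swap {x : M}
    (e : OrthonormalBasis (Fin n ⊕ Fin n) ℝ (TangentSpace 𝓘(ℝ, E) x))
    (H : TangentSpace 𝓘(ℝ, E) x [⋀^Fin 3]→ₗ[ℝ] ℂ) (i j k : Fin n ⊕ Fin n) :
    components e H i j k = -components e H i k j := by
  rw [components, components, ← Finset.sum_neg_distrib]
  refine Finset.sum_congr rfl fun μ _ ↦ ?_
  rw [Finset.sum_comm, ← Finset.sum_neg_distrib]
  refine Finset.sum_congr rfl fun ν _ ↦ ?_
  rw [← Finset.sum_neg_distrib]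
  refine Finset.sum_congr rfl fun κ _ ↦ ?_
  rw [threeForm_swap_right H (e μ) (e ν) (e κ)]
  ring

/-- If all components with fixed last two indices vanish, then so does the contraction of the
three-form with the corresponding two complex covectors. -/
theorem sum_frameCoeff_eq_zero {x : M}
    (e : OrthonormalBasis (Fin n ⊕ Fin n) ℝ (TangentSpace 𝓘(ℝ, E) x))
    (H : TangentSpace 𝓘(ℝ, E) x [⋀^Fin 3]→ₗ[ℝ] ℂ) {j k : Fin n ⊕ Fin n}
    (h : ∀ i, components e H i j k = 0) (Y : TangentSpace 𝓘(ℝ, E) x) :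
    ∑ ν, ∑ κ, H ![Y, e ν, e κ] * frameCoeff ν j * frameCoeff κ k = 0 := by
  let K (Y : TangentSpace 𝓘(ℝ, E) x) : ℂ :=
    ∑ ν, ∑ κ, H ![Y, e ν, e κ] * frameCoeff ν j * frameCoeff κ k
  have hK (i) : ∑ μ, K (e μ) * frameCoeff μ i = 0 := by
    rw [← h i, components]
    simp only [K, Finset.sum_mul]
    refine Finset.sum_congr rfl fun μ _ ↦ Finset.sum_congr rfl fun ν _ ↦
      Finset.sum_congr rfl fun κ _ ↦ ?_
    ring
  -- The one-form `K` vanishes on `E_ā` and, in the next step, on `E_a`, hence on the real frame;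
  -- the factor `2` clears the denominators of `frameCoeff`.
  have hl (a : Fin n) : K (e (.inl a)) - Complex.I * K (e (.inr a)) = 0 := by
    have := hK (.inl a)
    simp only [Fintype.sum_sum_type, frameCoeff, mul_ite, mul_zero, Finset.sum_ite_eq,
      Finset.mem_univ, if_true] at this
    linear_combination 2 * this
  have hr (a : Fin n) : K (e (.inl a)) + Complex.I * K (e (.inr a)) = 0 := by
    have := hK (.inr a)
    simp only [Fintype.sum_sum_type, frameCoeff, mul_ite, mul_zero, Finset.sum_ite_eq,
      Finset.mem_univ, if_true] at this
    linear_combination 2 * this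
  have hKe (μ) : K (e μ) = 0 := by
    rcases μ with a | a
    · linear_combination (hl a + hr a) / 2
    · linear_combination (Complex.I / 2) * (hl a - hr a) + K (e (.inr a)) * Complex.I_mul_I
  have hKY : K Y = ∑ μ, inner ℝ (e μ) Y • K (e μ) := by
    have hY (ν κ) : H ![Y, e ν, e κ] = ∑ μ, inner ℝ (e μ) Y • H ![e μ, e ν, e κ] := by
      have := congr(threeFormTrilinear H $(e.sum_repr' Y) (e ν) (e κ))
      simpa using this.symm
    simp only [K, hY, Finset.sum_mul, Finset.smul_sum, smul_mul_assoc]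
    conv_rhs => rw [Finset.sum_comm]
    refine Finset.sum_congr rfl fun ν _ ↦ ?_
    rw [Finset.sum_comm]
  change K Y = 0
  simp [hKY, hKe]

/-- The exterior product of two vectors as a bilinear map. -/
def wedge {V : Type*} [AddCommGroup V] [Module ℂ V] : V →ₗ[ℂ] V →ₗ[ℂ] ⋀[ℂ]^2 V :=
  LinearMap.mk₂ ℂ (fun a b ↦ exteriorPower.ιMulti ℂ 2 ![a, b])
    (fun a a' b ↦ (exteriorPower.ιMulti ℂ 2).map_vecCons_add ![b] a a')
    (fun c a b ↦ (exteriorPower.ιMulti ℂ 2).map_vecCons_smul ![b] c a)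
    (fun a b b' ↦ ((exteriorPower.ιMulti ℂ 2).curryLeft a).map_vecCons_add ![] b b')
    (fun c a b ↦ ((exteriorPower.ιMulti ℂ 2).curryLeft a).map_vecCons_smul ![] c b)

/-! ### The pure spinor as a vacuum, and the vanishing of the components. -/

namespace SpinorBundle

variable (B : SpinorBundle n E M F S)

/-- A frame vector acts on the pure spinor through the creation operators only. -/
theorem γ_apply_eq_sum {x : M} {e : OrthonormalBasis (Fin n ⊕ Fin n) ℝ (TangentSpace 𝓘(ℝ, E) x)}
    {η : S x} (he : B.IsAdapted e η) (μ : Fin n ⊕ Fin n) :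
    B.γ x (e μ) η =
      ∑ a, frameCoeff μ (Sum.inl a) • B.γC x (complexFrame e (Sum.inl a)) η := by
  have h := congr(B.γC x $(sum_frameCoeff e μ) η)
  rw [γC_tmul, one_smul] at h
  rw [← h, map_sum, LinearMap.sum_apply, Fintype.sum_sum_type]
  have hz (a : Fin n) : B.γC x (complexFrame e (Sum.inr a)) η = 0 := by
    rw [γC_complexFrame_inr]
    exact he a
  simp [hz]

/-- The zero spinor would have the whole `2n`-dimensional space as null space. -/
theorem IsPure.ne_zero {B : SpinorBundle n E M F S} (hn : n ≠ 0) {η : ∀ x, S x}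
    (hη : B.IsPure η) (x : M) : η x ≠ 0 := by
  intro h0
  have h : LinearMap.ker ((LinearMap.applyₗ (R := ℂ) (η x)).comp (B.γC x)) = ⊤ := by
    rw [LinearMap.ker_eq_top]
    ext
    simp [h0]
  have h1 := hη x
  have h2 : Module.finrank ℝ (TangentSpace 𝓘(ℝ, E) x) = 2 * n := B.finrank_model
  rw [h, finrank_top, Module.finrank_baseChange, h2] at h1
  omega

theorem gammaStar_mul_γC {x : M}
    (f : OrthonormalBasis (Fin (2 * n)) ℝ (TangentSpace 𝓘(ℝ, E) x))
    (e : Fin n ⊕ Fin n → TangentSpace 𝓘(ℝ, E) x) (a : Fin n) :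
    B.gammaStar f * B.γC x (complexFrame e (Sum.inl a)) =
      -(B.γC x (complexFrame e (Sum.inl a)) * B.gammaStar f) := by
  simp only [γC_complexFrame_inl, mul_add, add_mul, mul_smul_comm, smul_mul_assoc,
    gammaStar_mul_γ]
  module

theorem prod_γC_apply_ne_zero {x : M}
    {e : OrthonormalBasis (Fin n ⊕ Fin n) ℝ (TangentSpace 𝓘(ℝ, E) x)} {η : S x} (hη : η ≠ 0)
    (he : B.IsAdapted e η) :
    (List.ofFn fun a : Fin n ↦ B.γC x (complexFrame e (Sum.inl a))).prod η ≠ 0 := by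
  rw [List.ofFn_eq_map]
  refine prod_map_apply_ne_zero (h := fun a ↦ B.γC x (complexFrame e (Sum.inr a)))
    (c := -4) (by norm_num) (B.γC_barred_unbarred e) hη (fun a ↦ ?_) (List.nodup_finRange n)
  rw [γC_complexFrame_inr]
  exact he a

/-- The components `H^{iab}` with unbarred `a`, `b` vanish if the obstruction does. -/
theorem components_eq_zero_of_obstruction {m : ℕ} (B : SpinorBundle (m + 2) E M F S)
    (hn : 2 ≤ m + 2) {x : M}
    {e : OrthonormalBasis (Fin (m + 2) ⊕ Fin (m + 2)) ℝ (TangentSpace 𝓘(ℝ, E) x)}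
    {H : TangentSpace 𝓘(ℝ, E) x [⋀^Fin 3]→ₗ[ℝ] ℂ}
    {f : OrthonormalBasis (Fin (2 * (m + 2))) ℝ (TangentSpace 𝓘(ℝ, E) x)} {w : ℂ} {η : S x}
    (hη : η ≠ 0) (hw : B.gammaStar f η = w • η) (he : B.IsAdapted e η)
    (hH : B.obstruction hn e H (B.gammaStar f) w = 0)
    (i : Fin (m + 2) ⊕ Fin (m + 2)) (c d : Fin (m + 2)) :
    components e H i (Sum.inl c) (Sum.inl d) = 0 := by
  let g (a : Fin (m + 2)) := B.γC x (complexFrame e (Sum.inl a))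
  have hg : ∀ a b, g a * g b = -(g b * g a) := B.γC_unbarred_anticomm e
  let P (σ : Equiv.Perm (Fin (m + 2))) :=
    (List.ofFn fun j : Fin m ↦ g (σ j.castSucc.castSucc)).prod
  let k (σ : Equiv.Perm (Fin (m + 2))) : ℂ :=
    components e H i (Sum.inl (σ (Fin.last m).castSucc)) (Sum.inl (σ (Fin.last (m + 1)))) *
      ((Equiv.Perm.sign σ : ℤ) : ℂ)
  have hP (σ : Equiv.Perm (Fin (m + 2))) :
      antisymmProd (fun j : Fin m ↦ g (σ j.castSucc.castSucc)) = P σ :=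
    antisymmProd_eq_prod hg fun j : Fin m ↦ σ j.castSucc.castSucc
  have hΘ : (∑ σ, k σ • P σ) * (1 - ((-1) ^ m * w) • B.gammaStar f) = 0 := by
    simp only [SpinorBundle.obstruction, ← TensorProduct.sum_tmul] at hH
    have := eq_zero_of_sum_tmul_complexFrame e hH i
    rw [Finset.sum_mul]
    simp only [← hP, smul_mul_assoc]
    rw [pow_add, neg_one_sq, mul_one] at this
    exact this
  have hw2 : w * w = 1 := by
    have h1 := congr($(B.gammaStar_mul_self f) η)
    rw [Module.End.mul_apply, hw, map_smul, hw, smul_smul, Module.End.one_apply] at h1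
    exact smul_left_injective ℂ hη (h1.trans (one_smul ℂ η).symm)
  -- On this chirality the factor `1 - (-1)^m w γ^*` acts as `2`, because `w² = 1`.
  have hkill {v : S x} (hv : B.gammaStar f v = -((-1) ^ m * w) • v) :
      (∑ σ, k σ • P σ) v = 0 := by
    have h1 := congr($hΘ v)
    rw [Module.End.mul_apply, LinearMap.sub_apply, LinearMap.smul_apply, hv, smul_smul,
      Module.End.one_apply, LinearMap.zero_apply] at h1
    have h2 : v - ((-1) ^ m * w * -((-1) ^ m * w)) • v = (2 : ℂ) • v := by
      rw [show (-1) ^ m * w * -((-1) ^ m * w) = -(((-1) ^ m * (-1) ^ m) * (w * w)) by ring, hw2,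
        ← pow_add, Even.neg_one_pow (by simp)]
      module
    rw [h2, map_smul] at h1
    exact (smul_eq_zero.1 h1).resolve_left two_ne_zero
  have hstar (a : Fin (m + 2)) (v : S x) :
      B.gammaStar f (g a v) = -g a (B.gammaStar f v) :=
    congr($(B.gammaStar_mul_γC f e a) v)
  have hcomm (a : Fin (m + 2)) : g a * (∑ σ, k σ • P σ) =
      ((-1 : ℂ) ^ m) • ((∑ σ, k σ • P σ) * g a) := by
    rw [Finset.mul_sum, Finset.sum_mul, Finset.smul_sum]
    refine Finset.sum_congr rfl fun σ _ ↦ ?_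
    have := mul_prod_map_of_anticomm (A := g a) (g := fun j : Fin m ↦ g (σ j.castSucc.castSucc))
      (List.finRange m) fun b _ ↦ hg a _
    rw [← List.ofFn_eq_map, List.length_finRange] at this
    rw [mul_smul_comm, this, smul_comm, smul_mul_assoc]
  have hfin : (∑ σ, k σ • P σ) (g c (g d η)) = 0 := by
    -- Each `g a` flips the chirality `w` of `η`. For even `m` the killed chirality is `-w`, that of
    -- `g d η`, and `g c` is pulled out with `hcomm`; for odd `m` it is `w`, that of `g c (g d η)`.
    rcases m.even_or_odd with hm | hm
    · have h1 := hkill (v := g d η) (by rw [hstar, hw, map_smul, hm.neg_one_pow]; module)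
      have h2 := congr($(hcomm c) (g d η))
      rw [Module.End.mul_apply, h1, map_zero, hm.neg_one_pow, one_smul, Module.End.mul_apply] at h2
      exact h2.symm
    · refine hkill ?_
      rw [hstar, hstar, hw, map_smul, map_neg, map_smul, hm.neg_one_pow]
      module
  refine eq_zero_of_sum_perm_smul_prod_apply hg (B.prod_γC_apply_ne_zero hη he)
    (G := fun a b ↦ components e H i (Sum.inl a) (Sum.inl b))
    (fun a b ↦ components_swap e H i _ _) c d ?_
  simpa only [LinearMap.sum_apply, LinearMap.smul_apply] using hfin

/-! ### The torsion of a three-form connection. -/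

section Torsion

variable [∀ x, IsTopologicalAddGroup (S x)] [∀ x, ContinuousSMul ℝ (S x)]

/-- Since `γ` is parallel, the derivative terms cancel and only the algebraic action of `𝒜` and
`𝒜^C` remains. -/
theorem hatD_γ_eq [VectorBundle ℝ F S] [ContMDiffVectorBundle ∞ F S 𝓘(ℝ, E)]
    {nablaM : CovariantDerivative 𝓘(ℝ, E) E (fun x : M ↦ TangentSpace 𝓘(ℝ, E) x)}
    {nablaS : CovariantDerivative 𝓘(ℝ, E) F S} (hS : B.IsSpinLeviCivita nablaM nablaS)
    (A : ∀ x : M, TangentSpace 𝓘(ℝ, E) x →ₗ[ℝ] Module.End ℂ (S x))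
    {x : M} (v X : TangentSpace 𝓘(ℝ, E) x) (ξ : S x) :
    hatD_γ B nablaM (addForm nablaS A) (B.connC nablaS A) v X ξ =
      A x v (B.γ x X ξ) + B.γ x X (B.chargeAdj x (A x v) ξ) := by
  have h := hS.parallel_γ (FiberBundle.extend E X) (FiberBundle.extend F ξ) x v
    (FiberBundle.mdifferentiableAt_extend 𝓘(ℝ, E) E X)
    (FiberBundle.mdifferentiableAt_extend 𝓘(ℝ, E) F ξ)
  simp only [FiberBundle.extend_apply_self] at h
  rw [hatD_γ, connC, addForm_apply, addForm_apply, h]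
  simp [chargeAdjForm]
  abel

/-- The torsion of the connection given by a three-form. -/
theorem torsion_threeFormPotential [VectorBundle ℝ F S] [ContMDiffVectorBundle ∞ F S 𝓘(ℝ, E)]
    {nablaM : CovariantDerivative 𝓘(ℝ, E) E (fun x : M ↦ TangentSpace 𝓘(ℝ, E) x)}
    {nablaS : CovariantDerivative 𝓘(ℝ, E) F S} (hS : B.IsSpinLeviCivita nablaM nablaS)
    (H : ∀ x : M, TangentSpace 𝓘(ℝ, E) x [⋀^Fin 3]→ₗ[ℝ] ℂ)
    {x : M} (X Y : TangentSpace 𝓘(ℝ, E) x) (ξ : S x) :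
    B.torsion nablaM nablaS (B.threeFormPotential H) X Y ξ =
      (8 : ℂ) • ∑ κ, H x ![X, Y, frame x κ] • B.γ x (frame x κ) ξ := by
  have key (X Y : TangentSpace 𝓘(ℝ, E) x) :
      B.threeFormPotential H x X (B.γ x Y ξ) - B.γ x Y (B.threeFormPotential H x X ξ) =
        (4 : ℂ) • ∑ κ, H x ![X, Y, frame x κ] • B.γ x (frame x κ) ξ := by
    have h := congr($(sum_smul_antisymmProd_commutator (B.clifford x) (frame x) (H x) X Y) ξ)
    simp only [LinearMap.smul_apply, LinearMap.sum_apply (f := fun κ ↦ H x ![X, Y, frame x κ] •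
      B.γ x (frame x κ))] at h
    exact h
  rw [torsion, hatD_γ_eq B hS, hatD_γ_eq B hS]
  simp only [chargeAdj_threeFormPotential, LinearMap.neg_apply, map_neg, ← sub_eq_add_neg, key]
  simp only [threeForm_swap_left (H x) X Y, neg_smul, Finset.sum_neg_distrib]
  module

end Torsion

/-- The contraction of a three-form with `γ^μ η ∧ γ^κ η` does not depend on the orthonormal
basis. -/
theorem sum_wedge_eq {x : M} {ι κ : Type*} [Fintype ι] [Fintype κ]
    (H : TangentSpace 𝓘(ℝ, E) x [⋀^Fin 3]→ₗ[ℝ] ℂ) (Y : TangentSpace 𝓘(ℝ, E) x) (η : S x)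
    (f : OrthonormalBasis ι ℝ (TangentSpace 𝓘(ℝ, E) x))
    (e : OrthonormalBasis κ ℝ (TangentSpace 𝓘(ℝ, E) x)) :
    ∑ i, wedge (B.γ x (f i) η) (∑ j, H ![f i, Y, f j] • B.γ x (f j) η) =
      ∑ i, wedge (B.γ x (e i) η) (∑ j, H ![e i, Y, e j] • B.γ x (e j) η) := by
  -- The contraction over `j` is moved to the basis `e` first, the one over `i` afterwards. This
  -- passes from the frame that defines `𝔇` to the adapted one.
  have h1 (X : TangentSpace 𝓘(ℝ, E) x) : ∑ j, H ![X, Y, f j] • B.γ x (f j) η =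
      ∑ j, H ![X, Y, e j] • B.γ x (e j) η :=
    sum_orthonormalBasis_eq (LinearMap.mk₂ ℝ (fun u v ↦ threeFormTrilinear H X Y u • B.γ x v η)
      (fun u u' v ↦ by simp only [map_add, add_smul])
      (fun c u v ↦ by simp only [map_smul, smul_assoc])
      (fun u v v' ↦ by simp only [map_add, LinearMap.add_apply, smul_add])
      (fun c u v ↦ by
        simp only [map_smul, LinearMap.smul_apply, ← Complex.coe_smul, smul_smul, mul_comm])) f e
  simp only [h1]
  refine sum_orthonormalBasis_eq (LinearMap.mk₂ ℝ
    (fun u v ↦ wedge (B.γ x u η) (∑ j, threeFormTrilinear H v Y (e j) • B.γ x (e j) η))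
    (fun u u' v ↦ ?_) (fun c u v ↦ ?_) (fun u v v' ↦ ?_) (fun c u v ↦ ?_)) f e
  · simp only [map_add, LinearMap.add_apply]
  · simp only [map_smul, LinearMap.smul_apply, ← Complex.coe_smul]
  · simp only [map_add, LinearMap.add_apply, add_smul, Finset.sum_add_distrib]
  · simp only [map_smul, LinearMap.smul_apply, smul_assoc, ← Finset.smul_sum, ← Complex.coe_smul]

/-- Expanding both spinors in the `γ^a η` leaves, as coefficient of `γ^a η ∧ γ^b η`, the contraction
of `H(Y, ·, ·)` with two unbarred covectors. -/
theorem sum_wedge_eq_zero {x : M}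
    {e : OrthonormalBasis (Fin n ⊕ Fin n) ℝ (TangentSpace 𝓘(ℝ, E) x)} {η : S x}
    (he : B.IsAdapted e η) {H : TangentSpace 𝓘(ℝ, E) x [⋀^Fin 3]→ₗ[ℝ] ℂ}
    (hH : ∀ i a b, components e H i (Sum.inl a) (Sum.inl b) = 0) (Y : TangentSpace 𝓘(ℝ, E) x) :
    ∑ μ, wedge (B.γ x (e μ) η) (∑ κ, H ![e μ, Y, e κ] • B.γ x (e κ) η) = 0 := by
  let g (a : Fin n) : S x := B.γC x (complexFrame e (Sum.inl a)) η
  calc ∑ μ, wedge (B.γ x (e μ) η) (∑ κ, H ![e μ, Y, e κ] • B.γ x (e κ) η)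
      = ∑ μ, ∑ κ, ∑ a, ∑ b, (-(H ![Y, e μ, e κ] * frameCoeff μ (.inl a) * frameCoeff κ (.inl b))) •
          wedge (g a) (g b) := by
        refine Finset.sum_congr rfl fun μ _ ↦ ?_
        rw [map_sum]
        refine Finset.sum_congr rfl fun κ _ ↦ ?_
        rw [B.γ_apply_eq_sum he, B.γ_apply_eq_sum he, threeForm_swap_left H Y]
        simp only [map_smul, map_sum, LinearMap.sum_apply, LinearMap.smul_apply, Finset.smul_sum,
          smul_smul]
        rw [Finset.sum_comm]
        refine Finset.sum_congr rfl fun a _ ↦ Finset.sum_congr rfl fun b _ ↦ ?_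
        congr 1
        ring
    _ = ∑ a, ∑ b, (-∑ μ, ∑ κ, H ![Y, e μ, e κ] * frameCoeff μ (.inl a) * frameCoeff κ (.inl b)) •
          wedge (g a) (g b) := by
        simp only [← Finset.sum_neg_distrib, Finset.sum_smul]
        rw [Finset.sum_comm_cycle]
        refine Finset.sum_congr rfl fun a _ ↦ ?_
        rw [Finset.sum_comm_cycle]
    _ = 0 := by
        simp only [sum_frameCoeff_eq_zero e H (fun i ↦ hH i _ _), neg_zero, zero_smul,
          Finset.sum_const_zero]

end SpinorBundle

end SpinorTorsion

end

theorem proposition5p9 {n : ℕ} (hn : 2 ≤ n)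
    -- a smooth Riemannian manifold `M` of dimension `2 * n`
    {E : Type*} [NormedAddCommGroup E] [NormedSpace ℝ E] [FiniteDimensional ℝ E]
    {M : Type*} [TopologicalSpace M] [ChartedSpace E M] [IsManifold 𝓘(ℝ, E) ∞ M]
    [RiemannianBundle (fun x : M ↦ TangentSpace 𝓘(ℝ, E) x)]
    [IsContMDiffRiemannianBundle 𝓘(ℝ, E) ∞ E (fun x : M ↦ TangentSpace 𝓘(ℝ, E) x)]
    -- a spinor bundle `S` with charge conjugation
    {F : Type*} [NormedAddCommGroup F] [NormedSpace ℂ F]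
    {S : M → Type*} [TopologicalSpace (TotalSpace F S)]
    [∀ x, AddCommGroup (S x)] [∀ x, Module ℂ (S x)] [∀ x, TopologicalSpace (S x)]
    [∀ x, IsTopologicalAddGroup (S x)] [∀ x, ContinuousSMul ℝ (S x)]
    [FiberBundle F S] [VectorBundle ℂ F S] [VectorBundle ℝ F S]
    [ContMDiffVectorBundle ∞ F S 𝓘(ℝ, E)]
    (B : SpinorTorsion.SpinorBundle n E M F S)
    -- the Levi-Civita connections on `M` and on `S`
    (nablaM : CovariantDerivative 𝓘(ℝ, E) E (fun x : M ↦ TangentSpace 𝓘(ℝ, E) x))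
    (hM : SpinorTorsion.IsLeviCivita nablaM)
    (nablaS : CovariantDerivative 𝓘(ℝ, E) F S)
    (hS : B.IsSpinLeviCivita nablaM nablaS)
    -- a three-form `H`, which gives `D = ∇ + 𝒜`, and a pure spinor field `η`
    (H : ∀ x : M, TangentSpace 𝓘(ℝ, E) x [⋀^Fin 3]→ₗ[ℝ] ℂ)
    (η : ∀ x, S x) (hη : B.IsPure η)
    -- at the point `x`: `γ^*` for an orthonormal frame `f`, the chirality `w` of `η`, and an
    -- orthonormal frame `e` adapted to the complex structure given by `η`
    (x : M) (f : OrthonormalBasis (Fin (2 * n)) ℝ (TangentSpace 𝓘(ℝ, E) x))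
    (w : ℂ) (hw : B.gammaStar f (η x) = w • η x)
    (e : OrthonormalBasis (Fin n ⊕ Fin n) ℝ (TangentSpace 𝓘(ℝ, E) x))
    (he : B.IsAdapted e (η x))
    (hH : B.obstruction hn e (H x) (B.gammaStar f) w = 0) :
    B.frakD (fun _ ↦ B.torsion nablaM nablaS (B.threeFormPotential H)) η η x = 0 := by
  obtain ⟨m, rfl⟩ : ∃ m, n = m + 2 := ⟨n - 2, by omega⟩
  have hc := SpinorTorsion.SpinorBundle.components_eq_zero_of_obstruction B hn
    (hη.ne_zero (by omega) x) hw he hH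
  -- With `ν` as outer index, the `Λ²S` coefficient of each `e_ν` vanishes separately; its two
  -- summands coincide because both spinors are `η`.
  rw [SpinorTorsion.SpinorBundle.frakD, Finset.sum_comm]
  refine Finset.sum_eq_zero fun ν _ ↦ ?_
  rw [← TensorProduct.sum_tmul]
  have h : ∑ μ, SpinorTorsion.wedge (B.γ x (SpinorTorsion.frame x μ) (η x))
      (B.torsion nablaM nablaS (B.threeFormPotential H) (SpinorTorsion.frame x μ)
        (SpinorTorsion.frame x ν) (η x)) = 0 := by
    simp only [B.torsion_threeFormPotential hS, map_smul, ← Finset.smul_sum]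
    rw [B.sum_wedge_eq (H x) _ (η x) (SpinorTorsion.frame x) e, B.sum_wedge_eq_zero he hc,
      smul_zero]
  rw [Finset.sum_add_distrib]
  refine (congrArg (· ⊗ₜ[ℝ] SpinorTorsion.frame x ν) (congrArg₂ (· + ·) h h)).trans ?_
  simp
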